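/- **Setting.** Let $\mathcal R_0^*\subset(-\frac12,\frac12]^d$ be open and connected, let $\mathcal R_0$ be a Borel set with $\mathcal R_0^*\subset\mathcal R_0\subset\overline{\mathcal R_0^*}$, and let $e_1,\dots,e_d>0$. Let $\lambda_n>0$ be non-decreasing with $\lambda_n\to\infty$, let $\eta_n>0$ be non-increasing with $\eta_n\to0$ and $\eta_n=o(\lambda_n^{-d})$, and let $\delta_n>0$ be non-decreasing with $\delta_n\to\infty$ and $\delta_n=o(\log n)$. The sampling sites at stage $n$ are the points of $\{\eta_n(e_1k_1,\dots,e_dk_d):k\in\mathbb Z^d\}\cap\lambda_n\mathcal R_0$. For each $n$ let $s_n$ be a sampling site, and let $s_{n,1},\dots,s_{n,\Gamma_n}$, $\Gamma_n\ge1$, be distinct sampling sites within distance $\delta_n$ of $s_n$. Let $(Y_t,X_t)$, $t=1,2,\dots$, be i.i.d. copies of an $\mathbb R\times\mathbb R^p$-valued random field on $\mathbb R^d$. Write $Z_{n,t}=\big(X_t(s_n),(X_t(s_{n,l}))_{l\le\Gamma_n},(Y_t(s_{n,l}))_{l\le\Gamma_n}\big)$ and suppose that $$Y_t(s_n)=f_0(Z_{n,t})+\epsilon_t(s_n),\qquad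 E[\epsilon_t(s_n)\mid Z_{n,t}]=0,\qquad E[\epsilon_t(s_n)^2]=\sigma^2 .$$ Here $f_0=f_{0,n}$ is a composition $f_2\circ f_1$ of Hölder functions: for a fixed integer $k\ge0$ and fixed $\alpha_1,\alpha_2\in(0,1)$, each component of $f_1$ (respectively $f_2$) is $k$ times continuously differentiable, with $k$-th derivatives that are Hölder continuous with exponent $\alpha_1$ (respectively $\alpha_2$). Write $\|g\|_n=\big(\frac1n\sum_{t=1}^n g(Z_{n,t})^2\big)^{1/2}$ and $\mathbb L_n(f)=\frac1n\sum_{t=1}^n(Y_t(s_n)-f(Z_{n,t}))^2$. For a width $r=r_n$ and bounds $V_1=V_{1,n}>1$, $V_2=V_{2,n}>1$, the sieve $\mathcal F_{r,n}$ consists of the two-layer networks $$\vartheta_0+\sum_{i=1}^r\vartheta_i\tanh\Big(\sum_{j=1}^r\nu_{ij}\tanh\Big(\sum_{k=1}^p\sum_{l=1}^{\Gamma_n}\upsilon_{ijkl}X_k(s_{n,l})+\sum_{l=1}^{\Gamma_n}\upsilon_{ij(p+1)l}Y(s_{n,l})+\upsilon_{ij00}\Big)+\nu_{i0}\Big)$$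 with $\sum_{i=0}^r|\vartheta_i|\le V_2$, with $\sum_{j=0}^r|\nu_{ij}|\le V_2$ for every $i$, and with $|\upsilon_{ij00}|+\sum_{k=1}^{p+1}\sum_l|\upsilon_{ijkl}|\le V_1$ for all $i,j$. The sieve approximates $f_0$: there are (deterministic) $\pi_nf_0\in\mathcal F_{r,n}$ with $\|\pi_nf_0-f_0\|_n\to0$ in probability. The estimator $\hat f_n\in\mathcal F_{r,n}$ is a sieve estimator, that is, $\mathbb L_n(\hat f_n)\le\inf_{f\in\mathcal F_{r,n}}\mathbb L_n(f)+O_P(\Xi_n)$ for some $\Xi_n\to0$. **Theorem (Convergence).** Suppose that 1. for some $\psi,\beta$ with $0<\psi+\beta<1$: $\Gamma_n=o(n^\psi)$, $\lambda_n=o(n)$, $r=o(n^\beta)$, $V_2\sqrt{\sigma^2+1}=o(r^2)$ and $V_1V_2=o(\sqrt{\log n})$; 2. for every $n$ the class $\mathcal F_{r,n}$ has finite VC (subgraph) dimension $\nu=\nu_n$ and an envelope function bounded by $\min\{V_1,V_2\}$; 3. for some constant $C>0$ and every $n$, almost surely, $\log\mathcal N(\varphi,\mathcal F_{r,n},\|\cdot\|_n)\le\nu\,C\,\varphi^{-d}$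 for all $0<\varphi<1$, where $\mathcal N$ denotes the covering number. Then $\|\hat f_n-f_0\|_n\to0$ in probability as $n\to\infty$. -/

import Mathlib

open MeasureTheory ProbabilityTheory Filter Topology Asymptotics
open scoped NNReal ENNReal

namespace SpatialDNN

/-! ### Mixed-increasing spatial sampling design -/

/-- A mixed-increasing-domain fixed sampling design on `ℝᵈ`: a prototype region `R0`,
inflation factors `lam n`, a lattice with increments `e i`, lattice scales `eta n`, and
neighbourhood radii `delta n`. -/
structure SpatialDesign (d : ℕ) where
  R0star : Set (EuclideanSpace ℝ (Fin d))
  R0 : Set (EuclideanSpace ℝ (Fin d))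
  isOpen_R0star : IsOpen R0star
  isConnected_R0star : IsConnected R0star
  R0star_subset : ∀ x ∈ R0star, ∀ i, x i ∈ Set.Ioc (-(1 / 2) : ℝ) (1 / 2)
  measurableSet_R0 : MeasurableSet R0
  subset_R0 : R0star ⊆ R0
  R0_subset : R0 ⊆ closure R0star
  lam : ℕ → ℝ
  lam_pos : ∀ n, 0 < lam n
  lam_mono : Monotone lam
  lam_tendsto : Tendsto lam atTop atTop
  e : Fin d → ℝ
  e_pos : ∀ i, 0 < e i
  eta : ℕ → ℝ
  eta_pos : ∀ n, 0 < eta n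
  eta_anti : Antitone eta
  eta_tendsto : Tendsto eta atTop (𝓝 0)
  eta_isLittleO : eta =o[atTop] (fun n => ((lam n) ^ d)⁻¹)
  delta : ℕ → ℝ
  delta_pos : ∀ n, 0 < delta n
  delta_mono : Monotone delta
  delta_tendsto : Tendsto delta atTop atTop
  delta_isLittleO : delta =o[atTop] (fun n : ℕ => Real.log n)

namespace SpatialDesign

variable {d : ℕ} (D : SpatialDesign d)

/-- The inflated sampling region `R_n = lam n • R0`. -/
def region (n : ℕ) : Set (EuclideanSpace ℝ (Fin d)) :=
  {u | ∃ x ∈ D.R0, u = D.lam n • x}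

/-- The sampling sites: the points of the scaled lattice `eta n • (diag e) ℤᵈ` in `R_n`. -/
def sites (n : ℕ) : Set (EuclideanSpace ℝ (Fin d)) :=
  {u | (∃ k : Fin d → ℤ, ∀ i, u i = D.eta n * (D.e i * (k i : ℝ))) ∧ u ∈ D.region n}

/-- The sampling sites within distance `delta n` of `c`. -/
def neighbourhood (n : ℕ) (c : EuclideanSpace ℝ (Fin d)) : Set (EuclideanSpace ℝ (Fin d)) :=
  {u | u ∈ D.sites n ∧ dist u c ≤ D.delta n}

end SpatialDesign

/-! ### Inputs, the Hölder composition class, and the two-layer networks -/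

/-- The arguments of a regression function when `m` neighbouring sites are used: the covariates
at the target site, the covariates at the `m` neighbouring sites, and the responses there. -/
abbrev Input (p m : ℕ) : Type := (Fin p → ℝ) × (Fin m → Fin p → ℝ) × (Fin m → ℝ)

/-- The isotropic Hölder class: `f` is `k` times continuously differentiable and its `k`-th
derivative is Hölder continuous with exponent `a` (for some constant `M > 1`). -/
def IsHolder {E : Type*} [NormedAddCommGroup E] [NormedSpace ℝ E] (k : ℕ) (a : ℝ)
    (f : E → ℝ) : Prop :=
  ContDiff ℝ (k : ℕ∞) f ∧ ∃ M : ℝ, 1 < M ∧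
    ∀ x y, ‖iteratedFDeriv ℝ k f x - iteratedFDeriv ℝ k f y‖ ≤ M * ‖x - y‖ ^ a

/-- The class of compositions `f₂ ∘ f₁` of Hölder functions, the inner one being vector valued
with Hölder components. -/
def holderCompositions (E : Type*) [NormedAddCommGroup E] [NormedSpace ℝ E] (k : ℕ)
    (a₁ a₂ : ℝ) : Set (E → ℝ) :=
  {f | ∃ (q : ℕ) (f₁ : E → Fin q → ℝ) (f₂ : (Fin q → ℝ) → ℝ),
    (∀ j, IsHolder k a₁ (fun x => f₁ x j)) ∧ IsHolder k a₂ f₂ ∧ f = f₂ ∘ f₁}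

/-- Weights of a network with two hidden layers. -/
structure Weights (p m r : ℕ) where
  outBias : ℝ
  out : Fin r → ℝ
  midBias : Fin r → ℝ
  mid : Fin r → Fin r → ℝ
  inBias : Fin r → Fin r → ℝ
  inX : Fin r → Fin r → Fin p → Fin m → ℝ
  inY : Fin r → Fin r → Fin m → ℝ

/-- The function computed by the two-layer `tanh` network; only the covariates and responses at
the neighbouring sites are fed into it. -/
noncomputable def Weights.eval {p m r : ℕ} (w : Weights p m r) (z : Input p m) : ℝ :=
  w.outBias + ∑ i, w.out i * Real.tanh
    (∑ j, w.mid i j * Real.tanh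
        ((∑ k, ∑ l, w.inX i j k l * z.2.1 l k) + (∑ l, w.inY i j l * z.2.2 l) + w.inBias i j)
      + w.midBias i)

/-- The `ℓ¹` constraints on the weights: `V₂` for the output layer and for each unit of the
second hidden layer, `V₁` for each unit of the first hidden layer (biases included). -/
def Weights.Bounded {p m r : ℕ} (w : Weights p m r) (V₁ V₂ : ℝ) : Prop :=
  |w.outBias| + ∑ i, |w.out i| ≤ V₂ ∧
  (∀ i, |w.midBias i| + ∑ j, |w.mid i j| ≤ V₂) ∧
  ∀ i j, |w.inBias i j| + (∑ k, ∑ l, |w.inX i j k l|) + ∑ l, |w.inY i j l| ≤ V₁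

/-- The sieve of two-layer `tanh` networks of width `r` on `m` neighbouring sites. -/
def networks (p m r : ℕ) (V₁ V₂ : ℝ) : Set (Input p m → ℝ) :=
  {f | ∃ w : Weights p m r, w.Bounded V₁ V₂ ∧ f = w.eval}

/-! ### Empirical norm, empirical loss, VC dimension, covering numbers -/

/-- The empirical norm `‖g‖ₙ` at the sample points `z 0, …, z (n - 1)`. -/
noncomputable def empNorm {A : Type*} (n : ℕ) (z : ℕ → A) (g : A → ℝ) : ℝ :=
  Real.sqrt ((n : ℝ)⁻¹ * ∑ t ∈ Finset.range n, g (z t) ^ 2)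

/-- The empirical squared error loss of `f` on the sample `(z t, y t)`, `t < n`. -/
noncomputable def empLoss {A : Type*} (n : ℕ) (z : ℕ → A) (y : ℕ → ℝ) (f : A → ℝ) : ℝ :=
  (n : ℝ)⁻¹ * ∑ t ∈ Finset.range n, (y t - f (z t)) ^ 2

/-- The subgraphs `{(x, u) | u < f x}` of the functions `f ∈ F` shatter the finite set `S`. -/
def SubgraphsShatter {A : Type*} (F : Set (A → ℝ)) (S : Finset (A × ℝ)) : Prop :=
  ∀ T ⊆ S, ∃ f ∈ F, ∀ q ∈ S, (q ∈ T ↔ q.2 < f q.1)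

/-- The VC dimension of a class of real functions, i.e. that of its class of subgraphs. -/
noncomputable def vcDim {A : Type*} (F : Set (A → ℝ)) : ℕ∞ :=
  ⨆ (S : Finset (A × ℝ)) (_ : SubgraphsShatter F S), (S.card : ℕ∞)

/-- The `φ`-covering number of `F` for the empirical norm `‖·‖ₙ` at `z 0, …, z (n - 1)`: it is
the covering number of the set of rescaled vectors of values, because
`‖f - g‖ₙ` is the Euclidean distance between these vectors. -/
noncomputable def empCoveringNumber {A : Type*} (n : ℕ) (z : ℕ → A) (F : Set (A → ℝ))
    (φ : ℝ) : ℕ∞ :=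
  Metric.externalCoveringNumber φ.toNNReal
    ((fun f : A → ℝ => (WithLp.toLp 2 (fun t : Fin n => (Real.sqrt n)⁻¹ * f (z t)) :
      EuclideanSpace ℝ (Fin n))) '' F)

/-! ### The data and the estimator -/

section Data

variable {Ω : Type*} {d p : ℕ}

/-- The input of the regression function for the `t`-th copy of the random fields, the target
site `c` and the neighbouring sites `σ`. -/
def inputAt {m : ℕ} (X : ℕ → EuclideanSpace ℝ (Fin d) → Ω → Fin p → ℝ)
    (Y : ℕ → EuclideanSpace ℝ (Fin d) → Ω → ℝ) (c : EuclideanSpace ℝ (Fin d))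
    (σ : Fin m → EuclideanSpace ℝ (Fin d)) (t : ℕ) (ω : Ω) : Input p m :=
  (X t c ω, fun l => X t (σ l) ω, fun l => Y t (σ l) ω)

/-- `(Y t, X t)`, `t = 0, 1, …`, are independent and identically distributed copies of a
`(p + 1)`-dimensional random field. -/
structure IsIIDFields [MeasurableSpace Ω] (μ : Measure Ω)
    (X : ℕ → EuclideanSpace ℝ (Fin d) → Ω → Fin p → ℝ)
    (Y : ℕ → EuclideanSpace ℝ (Fin d) → Ω → ℝ) : Prop where
  measurable_X : ∀ t u, Measurable (X t u)
  measurable_Y : ∀ t u, Measurable (Y t u)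
  indep : iIndepFun
    (fun (t : ℕ) (ω : Ω) (u : EuclideanSpace ℝ (Fin d)) => (Y t u ω, X t u ω)) μ
  identDistrib : ∀ t, IdentDistrib
    (fun (ω : Ω) (u : EuclideanSpace ℝ (Fin d)) => (Y t u ω, X t u ω))
    (fun (ω : Ω) (u : EuclideanSpace ℝ (Fin d)) => (Y 0 u ω, X 0 u ω)) μ μ

/-- The nonlinear spatial regression model at the target site `c` with neighbouring sites `σ` and
regression function `f₀`: the response is `f₀` of the input plus a noise with conditional mean
zero given the input and with variance `sd ^ 2`. -/
structure IsRegression [MeasurableSpace Ω] (μ : Measure Ω) {m : ℕ}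
    (X : ℕ → EuclideanSpace ℝ (Fin d) → Ω → Fin p → ℝ)
    (Y noise : ℕ → EuclideanSpace ℝ (Fin d) → Ω → ℝ) (sd : ℝ)
    (c : EuclideanSpace ℝ (Fin d)) (σ : Fin m → EuclideanSpace ℝ (Fin d))
    (f₀ : Input p m → ℝ) : Prop where
  model : ∀ t ω, Y t c ω = f₀ (inputAt X Y c σ t ω) + noise t c ω
  memLp : ∀ t, MemLp (noise t c) 2 μ
  condMean : ∀ t,
    μ[noise t c | MeasurableSpace.comap (inputAt X Y c σ t) inferInstance] =ᵐ[μ] 0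
  variance : ∀ t, ∫ ω, noise t c ω ^ 2 ∂μ = sd ^ 2

/-- `fhat` is a sieve estimator for the losses `L` over the sieve `F`: it takes values in the
sieve and minimises the loss over it up to an error `O_P(Ξ n)` with `Ξ n → 0`. -/
structure IsSieveEstimator [MeasurableSpace Ω] (μ : Measure Ω) {A : ℕ → Type*}
    (F : ∀ n, Set (A n → ℝ)) (L : ∀ n, Ω → (A n → ℝ) → ℝ)
    (fhat : ∀ n, Ω → A n → ℝ) : Prop where
  mem : ∀ n ω, fhat n ω ∈ F n
  near_min : ∃ Ξ : ℕ → ℝ, Tendsto Ξ atTop (𝓝 0) ∧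
    ∀ ε : ℝ, 0 < ε → ∃ M : ℝ, ∀ᶠ n in atTop,
      μ {ω | (⨅ f : F n, L n ω f) + M * |Ξ n| < L n ω (fhat n ω)} ≤ ENNReal.ofReal ε

end Data

end SpatialDNN

namespace SpatialDNN

/-! ### Counting quantised patterns of `tanh` networks -/

/-! Near-minimality of `fhat` against an approximant `g` of `f₀` in the sieve gives, after expanding
the squares, that `‖fhat - f₀‖ₙ²` is at most `‖g - f₀‖ₙ²` plus the optimisation error plus twice the
empirical mean of `ε (fhat - g)`. Since `fhat` depends on the noise, it suffices that the empirical
mean of `ε f` tends to zero in probability uniformly over the sieve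
(`tendsto_measure_exists_network_deviation`).

By ℓ¹ duality this reduces to single units of the second hidden layer (`abs_sum_mul_network_le`).
Rounding both layers of a unit to a grid of mesh `1 / K` turns each layer into a collection of
half-space indicators. By Sauer–Shelah the rounded units then produce at most `(n + 1) ^ (dimension
* 2K)` patterns on any `n` inputs, whatever the size of the inner weights.

The noise has only a second moment and need not be independent of the inputs. It is truncated at
level `B` and recentred conditionally on the input, at an L¹ cost of order `1 / B`
(`exists_centred_truncation`). Hoeffding's inequality on events determined by the inputs then allows
a union bound over patterns that themselves depend on the inputs (`measure_exists_pattern_le`).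
Since `ψ + β < 1`, a power of `n` is left over, and it pays for truncation, rounding and entropy
together. -/

lemma sum_choose_le_succ_pow (n D : ℕ) :
    ∑ k ∈ Finset.Iic D, n.choose k ≤ (n + 1) ^ D := by
  induction D with
  | zero =>
    rw [show Finset.Iic 0 = {0} from rfl]
    simp
  | succ D ih =>
    have h : Finset.Iic (D + 1) = insert (D + 1) (Finset.Iic D) := by
      ext k; simp only [Finset.mem_Iic, Finset.mem_insert]; omega
    rw [h, Finset.sum_insert (by simp), pow_succ]
    have h₁ : n.choose (D + 1) ≤ n * (n + 1) ^ D :=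
      (Nat.choose_le_pow n (D + 1)).trans (by
        rw [pow_succ, mul_comm]; gcongr; omega)
    linarith [h₁, ih]

/-- The sets `{t | 0 ≤ L θ t}` defined by a linear map `L` form a class of polynomial size. -/
lemma exists_card_nonneg_sets_le {E ι : Type*} [AddCommGroup E] [Module ℝ E]
    [FiniteDimensional ℝ E] [Fintype ι] (L : E →ₗ[ℝ] ι → ℝ) :
    ∃ 𝒜 : Finset (Finset ι), (∀ θ, ∃ S ∈ 𝒜, ∀ t, t ∈ S ↔ 0 ≤ L θ t) ∧
      𝒜.card ≤ (Fintype.card ι + 1) ^ Module.finrank ℝ E := by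
  classical
  let 𝒜 : Finset (Finset ι) :=
    Finset.univ.filter (fun S => ∃ θ, ∀ t, t ∈ S ↔ 0 ≤ L θ t)
  refine ⟨𝒜, fun θ => ⟨Finset.univ.filter (fun t => 0 ≤ L θ t), ?_, by simp⟩, ?_⟩
  · simp only [𝒜, Finset.mem_filter, Finset.mem_univ, true_and]
    exact ⟨θ, by simp⟩
  -- Dudley's argument: on a shattered set larger than the dimension, the values of `L θ` satisfy a
  -- nontrivial linear relation, which forbids some sign pattern.
  have hdim : 𝒜.vcDim ≤ Module.finrank ℝ E := by
    refine Finset.sup_le fun S hS => ?_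
    rw [Finset.mem_shatterer] at hS
    by_contra! hlt
    let R : E →ₗ[ℝ] (S → ℝ) := (LinearMap.funLeft ℝ ℝ (Subtype.val : S → ι)).comp L
    have hR : LinearMap.range R < ⊤ := by
      refine lt_top_iff_ne_top.2 fun htop => ?_
      have h₁ := LinearMap.finrank_range_le R
      rw [htop, finrank_top, Module.finrank_fintype_fun_eq_card, Fintype.card_coe] at h₁
      omega
    obtain ⟨φ, hφ, hker⟩ := Submodule.exists_le_ker_of_lt_top _ hR
    -- Shattering provides `θ` with `R θ` nonnegative exactly where the coefficient of `φ` is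
    -- negative. Every term of `φ (R θ)` is then at most zero, and a positive coefficient makes its
    -- own term strictly negative, contradicting `φ (R θ) = 0`. Only positive coefficients give
    -- strictness, so the argument is run for `φ` and for `-φ`.
    have key : ∀ φ : Module.Dual ℝ (S → ℝ), LinearMap.range R ≤ LinearMap.ker φ →
        ∀ s, ¬ 0 < φ (Pi.single s 1) := by
      intro φ hker s hs
      obtain ⟨T, hT, hST⟩ := hS (t := (Finset.univ.filter
        (fun s : S => φ (Pi.single s 1) < 0)).map (Function.Embedding.subtype _)) (by
          intro x hx; simp at hx; exact hx.1)
      simp only [𝒜, Finset.mem_filter, Finset.mem_univ, true_and] at hT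
      obtain ⟨θ, hθ⟩ := hT
      have hmem : ∀ s : S, 0 ≤ R θ s ↔ φ (Pi.single s 1) < 0 := by
        intro s
        have : (s : ι) ∈ S ∩ T ↔ φ (Pi.single s 1) < 0 := by
          rw [hST]; simp
        rw [← this, Finset.mem_inter, hθ]
        simp [R, LinearMap.funLeft_apply]
      have h0 : φ (R θ) = 0 := hker ⟨θ, rfl⟩
      have hsum : φ (R θ) = ∑ s, R θ s * φ (Pi.single s 1) := by
        conv_lhs => rw [← Finset.univ_sum_single (R θ)]
        rw [map_sum]
        refine Finset.sum_congr rfl fun s _ => ?_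
        rw [← smul_eq_mul, ← map_smul]
        congr 1
        rw [← Pi.single_smul]; simp
      have hneg : ∑ s, R θ s * φ (Pi.single s 1) < 0 := by
        refine Finset.sum_neg' (fun i _ => ?_) ⟨s, Finset.mem_univ _, ?_⟩
        · by_cases h : φ (Pi.single i 1) < 0
          · exact mul_nonpos_of_nonneg_of_nonpos ((hmem i).2 h) h.le
          · exact mul_nonpos_of_nonpos_of_nonneg
              (not_le.1 fun h' => h ((hmem i).1 h')).le (not_lt.1 h)
        · exact mul_neg_of_neg_of_pos (not_le.1 fun h' => hs.not_gt ((hmem s).1 h')) hs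
      linarith
    refine hφ (LinearMap.pi_ext' fun s => LinearMap.ext_ring ?_)
    have h₁ := key φ hker s
    have h₂ := key (-φ) (fun x hx => by
      have := hker hx
      simp only [LinearMap.mem_ker, LinearMap.neg_apply] at this ⊢
      rw [this, neg_zero]) s
    simp only [LinearMap.neg_apply] at h₂
    simp only [LinearMap.coe_comp, LinearMap.coe_single, Function.comp_apply,
      LinearMap.zero_comp, LinearMap.zero_apply]
    linarith
  calc 𝒜.card ≤ 𝒜.shatterer.card := Finset.card_le_card_shatterer 𝒜
    _ ≤ ∑ k ∈ Finset.Iic 𝒜.vcDim, (Fintype.card ι).choose k :=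
      Finset.card_shatterer_le_sum_vcDim
    _ ≤ (Fintype.card ι + 1) ^ 𝒜.vcDim := sum_choose_le_succ_pow _ _
    _ ≤ _ := Nat.pow_le_pow_right (by omega) hdim

lemma strictMono_tanh : StrictMono Real.tanh := by
  intro x y hxy
  by_contra! h
  have := Real.artanh_le_artanh (Real.neg_one_lt_tanh y) (Real.tanh_lt_one x) h
  rw [Real.artanh_tanh, Real.artanh_tanh] at this
  linarith

lemma hasDerivAt_tanh (x : ℝ) : HasDerivAt Real.tanh (1 / Real.cosh x ^ 2) x := by
  have h : Real.tanh = fun x => Real.sinh x / Real.cosh x :=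
    funext Real.tanh_eq_sinh_div_cosh
  rw [h]
  have h' := (Real.hasDerivAt_sinh x).div (Real.hasDerivAt_cosh x) (Real.cosh_pos x).ne'
  rw [← sq, ← sq, Real.cosh_sq_sub_sinh_sq] at h'
  exact h'

lemma abs_tanh_sub_le (x y : ℝ) : |Real.tanh x - Real.tanh y| ≤ |x - y| := by
  have h : LipschitzWith 1 Real.tanh := by
    refine lipschitzWith_of_nnnorm_deriv_le (fun x => (hasDerivAt_tanh x).differentiableAt)
      fun x => ?_
    rw [(hasDerivAt_tanh x).deriv, ← NNReal.coe_le_coe, coe_nnnorm, Real.norm_eq_abs,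
      NNReal.coe_one, abs_of_nonneg (by positivity), div_le_one (by positivity)]
    exact one_le_pow₀ (Real.one_le_cosh x)
  simpa [Real.dist_eq] using h.dist_le_mul x y

lemma continuous_tanh : Continuous Real.tanh :=
  continuous_iff_continuousAt.2 fun x => (hasDerivAt_tanh x).continuousAt

/-- The index of the cell of mesh `1 / K` that contains `tanh x`. -/
noncomputable def tanhCell (K : ℕ) (x : ℝ) : ℤ := ⌊K * Real.tanh x⌋

lemma measurable_tanhCell (K : ℕ) : Measurable (tanhCell K) :=
  Int.measurable_floor.comp (continuous_tanh.measurable.const_mul _)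

lemma tanhCell_mem_Icc (K : ℕ) (x : ℝ) : tanhCell K x ∈ Finset.Icc (-K : ℤ) K := by
  have h := abs_le.1 (Real.abs_tanh_lt_one x).le
  have hK : (0 : ℝ) ≤ K := K.cast_nonneg
  rw [Finset.mem_Icc]
  refine ⟨Int.le_floor.2 (by push_cast; nlinarith), Int.floor_le_iff.2 (by push_cast; nlinarith)⟩

lemma abs_tanh_sub_tanhCell_le {K : ℕ} (hK : 0 < K) (x : ℝ) :
    |Real.tanh x - tanhCell K x / K| ≤ 1 / K := by
  have hK' : (0 : ℝ) < K := Nat.cast_pos.2 hK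
  have h₁ := Int.floor_le (K * Real.tanh x)
  have h₂ := Int.lt_floor_add_one (K * Real.tanh x)
  have h : Real.tanh x - tanhCell K x / K = (K * Real.tanh x - tanhCell K x) / K := by
    field_simp
  rw [h, abs_div, Nat.abs_cast]
  gcongr
  rw [tanhCell, abs_le]
  constructor <;> linarith

/-- The cell patterns of the functions `tanh (L θ)` are polynomially many. -/
lemma exists_card_tanhCell_patterns_le {E ι : Type*} [AddCommGroup E] [Module ℝ E]
    [FiniteDimensional ℝ E] [Fintype ι] (L : E →ₗ[ℝ] ι → ℝ) (hL : ∃ θ, ∀ t, L θ t = 1)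
    (K : ℕ) :
    ∃ P : Finset (ι → ℤ), (∀ θ, (fun t => tanhCell K (L θ t)) ∈ P) ∧
      P.card ≤ (Fintype.card ι + 1) ^ (Module.finrank ℝ E * (2 * K)) := by
  classical
  obtain ⟨θ₁, hθ₁⟩ := hL
  obtain ⟨𝒜, h𝒜, hcard⟩ := exists_card_nonneg_sets_le L
  -- The threshold `-K` is always reached and, for `K > 0`, the threshold `K` never is, because
  -- `|tanh| < 1`. A cell index is therefore `-K` plus the number of interior thresholds it reaches,
  -- which is what `decode` computes.
  let J : Finset ℤ := Finset.Ioo (-K : ℤ) K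
  let decode : (J → Finset ι) → ι → ℤ := fun S t =>
    -K + ((Finset.univ.filter fun j : J => t ∈ S j).card : ℤ)
  refine ⟨(Fintype.piFinset fun _ : J => 𝒜).image decode, fun θ => ?_, ?_⟩
  · have hmem : ∀ j : J, ∃ S ∈ 𝒜, ∀ t, t ∈ S ↔ (j : ℤ) ≤ tanhCell K (L θ t) := by
      intro j
      obtain ⟨hj₁, hj₂⟩ := Finset.mem_Ioo.1 j.2
      have hK : (0 : ℝ) < K := by
        have : (0 : ℤ) < K := by omega
        exact_mod_cast this
      -- Since the constant function is in the range of `L`, the threshold `tanh (L θ t) ≥ j / K`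
      -- can be moved into the parameter and becomes a plain sign condition.
      obtain ⟨S, hS, hSt⟩ := h𝒜 (θ - Real.artanh (((j : ℤ) : ℝ) / K) • θ₁)
      refine ⟨S, hS, fun t => ?_⟩
      have hr : (((j : ℤ) : ℝ) / K) ∈ Set.Ioo (-1 : ℝ) 1 := by
        rw [Set.mem_Ioo, lt_div_iff₀ hK, div_lt_one hK]
        constructor
        · have : ((-K : ℤ) : ℝ) < ((j : ℤ) : ℝ) := by exact_mod_cast hj₁
          push_cast at this; linarith
        · exact_mod_cast hj₂
      rw [hSt, map_sub, map_smul, Pi.sub_apply, Pi.smul_apply, hθ₁, smul_eq_mul, mul_one,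
        sub_nonneg, tanhCell, Int.le_floor, ← strictMono_tanh.le_iff_le, Real.tanh_artanh hr,
        div_le_iff₀ hK, mul_comm]
    choose S hS hSt using hmem
    refine Finset.mem_image.2 ⟨S, Fintype.mem_piFinset.2 hS, funext fun t => ?_⟩
    have h₁ := Finset.mem_Icc.1 (tanhCell_mem_Icc K (L θ t))
    have h₂ : tanhCell K (L θ t) < K ∨ K = 0 := by
      rcases Nat.eq_zero_or_pos K with h | h
      · exact Or.inr h
      · left
        rw [tanhCell, Int.floor_lt]
        have : (0 : ℝ) < K := by exact_mod_cast h
        push_cast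
        nlinarith [Real.tanh_lt_one (L θ t)]
    have h₃ : (Finset.univ.filter fun j : J => t ∈ S j).card
        = (Finset.Ioc (-K : ℤ) (tanhCell K (L θ t))).card := by
      rw [← Finset.card_map (Function.Embedding.subtype (· ∈ J))]
      congr 1
      ext j
      simp only [Finset.mem_map, Finset.mem_filter, Finset.mem_univ, true_and, hSt,
        Function.Embedding.subtype_apply, Subtype.exists, exists_and_left, exists_prop,
        exists_eq_right_right, J, Finset.mem_Ioo, Finset.mem_Ioc]
      omega
    simp only [decode, h₃, Int.card_Ioc]
    omega
  · calc _ ≤ (Fintype.piFinset fun _ : J => 𝒜).card := Finset.card_image_le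
      _ = 𝒜.card ^ J.card := by simp
      _ ≤ ((Fintype.card ι + 1) ^ Module.finrank ℝ E) ^ J.card := Nat.pow_le_pow_left hcard _
      _ = (Fintype.card ι + 1) ^ (Module.finrank ℝ E * J.card) := (pow_mul _ _ _).symm
      _ ≤ _ := by
        refine Nat.pow_le_pow_right (by omega) (Nat.mul_le_mul_left _ ?_)
        simp only [J, Int.card_Ioo]
        omega

/-- The linear functions with a constant term of `r` inputs, evaluated at the points `T`. -/
noncomputable def affineEval {ι : Type*} {r : ℕ} (T : Fin r → ι → ℝ) :
    ((Fin r → ℝ) × ℝ) →ₗ[ℝ] ι → ℝ where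
  toFun w t := ∑ j, w.1 j * T j t + w.2
  map_add' v w := by
    ext t
    simp only [Prod.fst_add, Prod.snd_add, Pi.add_apply, add_mul, Finset.sum_add_distrib]
    ring
  map_smul' c w := by
    ext t
    simp only [Prod.smul_fst, Prod.smul_snd, Pi.smul_apply, smul_eq_mul, RingHom.id_apply,
      mul_add, Finset.mul_sum, mul_assoc]

/-- The cell patterns of two-layer units, both layers quantised, are few. -/
lemma exists_card_two_layer_patterns_le {E ι : Type*} [AddCommGroup E] [Module ℝ E]
    [FiniteDimensional ℝ E] [Fintype ι] (L : E →ₗ[ℝ] ι → ℝ) (hL : ∃ θ, ∀ t, L θ t = 1)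
    (K r : ℕ) :
    ∃ P : Finset (ι → ℤ),
      (∀ (θ : Fin r → E) (v : Fin r → ℝ) (v₀ : ℝ),
        (fun t => tanhCell K (∑ j, v j * (tanhCell K (L (θ j) t) / K) + v₀)) ∈ P) ∧
      P.card ≤ (Fintype.card ι + 1) ^ ((Module.finrank ℝ E * r + (r + 1)) * (2 * K)) := by
  classical
  obtain ⟨P₁, hP₁, hcard₁⟩ := exists_card_tanhCell_patterns_le L hL K
  -- Once the `r` rounded patterns of the first layer are fixed, the second layer is again a linear
  -- family, now in `r + 1` parameters. The two counts multiply.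
  have h₂ := fun T : Fin r → ι → ℤ => exists_card_tanhCell_patterns_le
    (affineEval fun j t => (T j t / K : ℝ)) ⟨(0, 1), fun t => by simp [affineEval]⟩ K
  choose P₂ hP₂ hcard₂ using h₂
  refine ⟨(Fintype.piFinset fun _ : Fin r => P₁).biUnion P₂, fun θ v v₀ => ?_, ?_⟩
  · refine Finset.mem_biUnion.2 ⟨fun j t => tanhCell K (L (θ j) t),
      Fintype.mem_piFinset.2 fun j => hP₁ (θ j), ?_⟩
    exact hP₂ (fun j t => tanhCell K (L (θ j) t)) (v, v₀)
  · refine (Finset.card_biUnion_le_card_mul _ _ _ fun T _ => hcard₂ T).trans ?_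
    have hfin : Module.finrank ℝ ((Fin r → ℝ) × ℝ) = r + 1 := by simp
    rw [hfin, Fintype.card_piFinset_const, add_mul (_ * r), pow_add]
    refine Nat.mul_le_mul_right _ ((Nat.pow_le_pow_left hcard₁ _).trans_eq ?_)
    rw [← pow_mul]
    congr 1
    ring

/-! ### A conditional exponential inequality and its uniform version over patterns -/

section Exponential

variable {Ω A ι : Type*} [MeasurableSpace Ω] [MeasurableSpace A] [Fintype ι] {μ : Measure Ω}

/-- If each density factor integrates to the constant `c t` given `Z t`, then the product of
the factors integrates to `∏ c t` given all of `Z`. -/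
lemma setLIntegral_prod_eq_of_iIndepFun [IsProbabilityMeasure μ] (Z : ι → Ω → A)
    (e : ι → Ω → ℝ) (hZ : ∀ t, Measurable (Z t)) (he : ∀ t, Measurable (e t))
    (hind : iIndepFun (fun t ω => (Z t ω, e t ω)) μ) (φ : ι → A × ℝ → ℝ≥0∞)
    (hφ : ∀ t, Measurable (φ t)) (c : ι → ℝ≥0)
    (hc : ∀ t S, MeasurableSet S →
      ∫⁻ ω in Z t ⁻¹' S, φ t (Z t ω, e t ω) ∂μ = c t * μ (Z t ⁻¹' S))
    {S : Set (ι → A)} (hS : MeasurableSet S) :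
    ∫⁻ ω in (fun ω t => Z t ω) ⁻¹' S, ∏ t, φ t (Z t ω, e t ω) ∂μ
      = (∏ t, (c t : ℝ≥0∞)) * μ ((fun ω t => Z t ω) ⁻¹' S) := by
  have hpair : ∀ t, Measurable fun ω => (Z t ω, e t ω) := fun t => (hZ t).prodMk (he t)
  have hZall : Measurable fun ω t => Z t ω := measurable_pi_lambda _ hZ
  have hprod : Measurable fun ω => ∏ t, φ t (Z t ω, e t ω) :=
    Finset.measurable_prod _ fun t _ => (hφ t).comp (hpair t)
  have hpre : ∀ s : ι → Set A,
      (fun ω t => Z t ω) ⁻¹' (Set.univ.pi s) = ⋂ t, Z t ⁻¹' s t := by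
    intro s; ext ω; simp
  -- As functions of `S`, both sides of the claim are measures. Each is identified with the same
  -- product measure by its values on boxes: `h₁` uses independence of the pairs, `h₂` independence
  -- of the `Z t`.
  have h₁ : Measure.pi (fun t => c t • μ.map (Z t))
      = (μ.withDensity fun ω => ∏ t, φ t (Z t ω, e t ω)).map (fun ω t => Z t ω) := by
    refine Measure.pi_eq fun s hs => ?_
    have hm : ∀ t, Measurable ((s t ×ˢ (Set.univ : Set ℝ)).indicator (φ t)) := fun t =>
      (hφ t).indicator ((hs t).prod MeasurableSet.univ)
    rw [Measure.map_apply hZall (MeasurableSet.univ_pi hs),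
      withDensity_apply _ (hZall (MeasurableSet.univ_pi hs)), hpre,
      ← lintegral_indicator (MeasurableSet.iInter fun t => hZ t (hs t))]
    have hind' := hind.comp (fun t => (s t ×ˢ (Set.univ : Set ℝ)).indicator (φ t)) hm
    have h := lintegral_prod_eq_prod_lintegral_of_indepFun Finset.univ _ hind'
      (fun t => (hm t).comp (hpair t))
    have hl : (fun ω => (⋂ t, Z t ⁻¹' s t).indicator
          (fun ω => ∏ t, φ t (Z t ω, e t ω)) ω)
        = fun ω => ∏ t, ((s t ×ˢ (Set.univ : Set ℝ)).indicator (φ t) ∘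
          fun ω => (Z t ω, e t ω)) ω := by
      ext ω
      by_cases hω : ω ∈ ⋂ t, Z t ⁻¹' s t
      · rw [Set.indicator_of_mem hω]
        refine Finset.prod_congr rfl fun t _ => ?_
        rw [Function.comp_apply, Set.indicator_of_mem]
        exact ⟨Set.mem_iInter.1 hω t, trivial⟩
      · rw [Set.indicator_of_notMem hω]
        simp only [Set.mem_iInter, not_forall] at hω
        obtain ⟨t, ht⟩ := hω
        refine (Finset.prod_eq_zero (Finset.mem_univ t) ?_).symm
        rw [Function.comp_apply, Set.indicator_of_notMem]
        exact fun h => ht h.1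
    rw [hl, h]
    refine Finset.prod_congr rfl fun t _ => ?_
    rw [Measure.smul_apply, Measure.map_apply (hZ t) (hs t), ENNReal.smul_def, smul_eq_mul,
      ← hc t _ (hs t), ← lintegral_indicator (hZ t (hs t))]
    refine lintegral_congr fun ω => ?_
    by_cases hω : Z t ω ∈ s t
    · rw [Function.comp_apply, Set.indicator_of_mem (by exact ⟨hω, trivial⟩),
        Set.indicator_of_mem (by exact hω)]
    · rw [Function.comp_apply, Set.indicator_of_notMem (fun h => hω h.1),
        Set.indicator_of_notMem (by exact hω)]
  have h₂ : Measure.pi (fun t => c t • μ.map (Z t))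
      = (∏ t, (c t : ℝ≥0∞)) • μ.map (fun ω t => Z t ω) := by
    refine Measure.pi_eq fun s hs => ?_
    rw [Measure.smul_apply, Measure.map_apply hZall (MeasurableSet.univ_pi hs), hpre,
      smul_eq_mul]
    have h := (hind.comp (fun _ => Prod.fst) fun _ => measurable_fst).measure_inter_preimage_eq_mul
      Finset.univ (sets := s) (fun t _ => hs t)
    simp only [Finset.mem_univ, Set.iInter_true] at h
    have h' : μ (⋂ t, Z t ⁻¹' s t) = ∏ t, μ (Z t ⁻¹' s t) := h
    rw [h', ← Finset.prod_mul_distrib]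
    refine Finset.prod_congr rfl fun t _ => ?_
    rw [Measure.smul_apply, Measure.map_apply (hZ t) (hs t), ENNReal.smul_def, smul_eq_mul]
  have h := congrArg (fun m => m S) (h₁.symm.trans h₂)
  simp only [Measure.smul_apply, smul_eq_mul] at h
  rw [Measure.map_apply hZall hS, Measure.map_apply hZall hS,
    withDensity_apply _ (hZall hS)] at h
  exact h

/-- Convexity puts the exponential below its chord on `[-c, c]`. The majorant is affine in `w`, so a
centred `w` integrates to exactly `cosh c`. -/
lemma exp_mul_le_cosh_add_mul_sinh {w : ℝ} (hw : |w| ≤ 1) (c : ℝ) :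
    Real.exp (c * w) ≤ Real.cosh c + w * Real.sinh c := by
  obtain ⟨h₁, h₂⟩ := abs_le.1 hw
  have h := (convexOn_exp : ConvexOn ℝ Set.univ Real.exp).2 (Set.mem_univ c) (Set.mem_univ (-c))
    (show 0 ≤ (1 + w) / 2 by linarith) (show 0 ≤ (1 - w) / 2 by linarith) (by ring)
  simp only [smul_eq_mul] at h
  rw [Real.cosh_eq, Real.sinh_eq]
  calc Real.exp (c * w) = Real.exp ((1 + w) / 2 * c + (1 - w) / 2 * -c) := by ring_nf
    _ ≤ _ := h
    _ = _ := by ring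

/-- Hoeffding's inequality for bounded noise that is conditionally centred given `Z`, on an
event that depends on `Z` only. -/
lemma measure_inter_le_exp_mul [IsProbabilityMeasure μ] (Z : ι → Ω → A)
    (e : ι → Ω → ℝ) (hZ : ∀ t, Measurable (Z t)) (he : ∀ t, Measurable (e t))
    (hind : iIndepFun (fun t ω => (Z t ω, e t ω)) μ) {B : ℝ} (hB : 0 < B)
    (hbd : ∀ t, ∀ᵐ ω ∂μ, |e t ω| ≤ B)
    (hmean : ∀ t S, MeasurableSet S → ∫ ω in Z t ⁻¹' S, e t ω ∂μ = 0)
    (u : ι → ℝ) (hu : ∀ t, |u t| ≤ 1) {S : Set (ι → A)} (hS : MeasurableSet S)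
    {s : ℝ} (hs : 0 ≤ s) :
    μ ((fun ω t => Z t ω) ⁻¹' S ∩ {ω | s ≤ ∑ t, e t ω * u t})
      ≤ ENNReal.ofReal (Real.exp (-(s ^ 2 / (2 * Fintype.card ι * B ^ 2)))) *
        μ ((fun ω t => Z t ω) ⁻¹' S) := by
  set n : ℝ := (Fintype.card ι : ℝ) with hn
  -- The Chernoff parameter minimising `n * l ^ 2 * B ^ 2 / 2 - l * s`.
  set l : ℝ := s / (n * B ^ 2) with hl
  have hl0 : 0 ≤ l := by positivity
  have hZall : Measurable fun ω t => Z t ω := measurable_pi_lambda _ hZ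
  have hint : ∀ t, Integrable (e t) μ := fun t =>
    Integrable.of_bound (he t).aestronglyMeasurable B (hbd t)
  -- The chord replaces the exponential because its integral over every event of `Z t` is an exact
  -- constant multiple of the probability, as `setLIntegral_prod_eq_of_iIndepFun` requires.
  let φ : ι → A × ℝ → ℝ≥0∞ := fun t x =>
    ENNReal.ofReal (Real.cosh (l * u t * B) + x.2 / B * Real.sinh (l * u t * B))
  have hφ : ∀ t, Measurable (φ t) := fun t => by fun_prop
  have hexp : ∀ t, ∀ᵐ ω ∂μ, Real.exp (l * (e t ω * u t))
      ≤ Real.cosh (l * u t * B) + e t ω / B * Real.sinh (l * u t * B) := by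
    intro t
    filter_upwards [hbd t] with ω hω
    have hw : |e t ω / B| ≤ 1 := by
      rw [abs_div, abs_of_pos hB, div_le_one hB]; exact hω
    refine le_of_eq_of_le ?_ (exp_mul_le_cosh_add_mul_sinh hw (l * u t * B))
    congr 1
    field_simp
  have hc : ∀ t R, MeasurableSet R → ∫⁻ ω in Z t ⁻¹' R, φ t (Z t ω, e t ω) ∂μ
      = (Real.cosh (l * u t * B)).toNNReal * μ (Z t ⁻¹' R) := by
    intro t R hR
    have hi : Integrable (fun ω => e t ω / B * Real.sinh (l * u t * B)) μ :=
      ((hint t).div_const B).mul_const _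
    rw [← ofReal_integral_eq_lintegral_ofReal]
    · rw [integral_add (integrable_const _) hi.integrableOn, integral_mul_const,
        integral_div, hmean t R hR, setIntegral_const, zero_div, zero_mul, add_zero,
        smul_eq_mul, mul_comm, ENNReal.ofReal_mul (Real.cosh_pos _).le, measureReal_def,
        ENNReal.ofReal_toReal (measure_ne_top _ _)]
      rfl
    · exact ((integrable_const _).add hi).integrableOn
    · exact ae_restrict_of_ae ((hexp t).mono fun ω h => (Real.exp_pos _).le.trans h)
  have hmain := setLIntegral_prod_eq_of_iIndepFun Z e hZ he hind φ hφ _ hc hS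
  have hmeasS : MeasurableSet ((fun ω t => Z t ω) ⁻¹' S ∩ {ω | s ≤ ∑ t, e t ω * u t}) :=
    (hZall hS).inter (measurableSet_le measurable_const
      (Finset.measurable_sum _ fun t _ => (he t).mul_const _))
  have hprod : ∏ t, ((Real.cosh (l * u t * B)).toNNReal : ℝ≥0∞)
      ≤ ENNReal.ofReal (Real.exp (n * (l ^ 2 * B ^ 2 / 2))) := by
    have : ∏ t, ((Real.cosh (l * u t * B)).toNNReal : ℝ≥0∞)
        ≤ ∏ _t : ι, ENNReal.ofReal (Real.exp (l ^ 2 * B ^ 2 / 2)) := by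
      refine Finset.prod_le_prod' fun t _ => ENNReal.ofReal_le_ofReal ?_
      refine (Real.cosh_le_exp_half_sq _).trans (Real.exp_le_exp.2 ?_)
      have h1 : u t ^ 2 ≤ 1 := (sq_le_one_iff_abs_le_one _).2 (hu t)
      have h2 : 0 ≤ l ^ 2 * B ^ 2 := by positivity
      nlinarith
    refine this.trans_eq ?_
    rw [Finset.prod_const, Finset.card_univ, ← ENNReal.ofReal_pow (Real.exp_pos _).le,
      ← Real.exp_nat_mul]
  calc μ ((fun ω t => Z t ω) ⁻¹' S ∩ {ω | s ≤ ∑ t, e t ω * u t})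
      = ∫⁻ _ω in (fun ω t => Z t ω) ⁻¹' S ∩ {ω | s ≤ ∑ t, e t ω * u t}, 1 ∂μ := by simp
    _ ≤ ∫⁻ ω in (fun ω t => Z t ω) ⁻¹' S ∩ {ω | s ≤ ∑ t, e t ω * u t},
          ENNReal.ofReal (Real.exp (-(l * s))) * ∏ t, φ t (Z t ω, e t ω) ∂μ := by
        refine setLIntegral_mono_ae' hmeasS ?_
        filter_upwards [ae_all_iff.2 hexp] with ω hω hmem
        have h1 : Real.exp (l * s) ≤ ∏ t, Real.exp (l * (e t ω * u t)) := by
          rw [← Real.exp_sum, ← Finset.mul_sum]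
          exact Real.exp_le_exp.2 (mul_le_mul_of_nonneg_left hmem.2 hl0)
        have h2 : Real.exp (l * s) ≤ ∏ t, (Real.cosh (l * u t * B)
            + e t ω / B * Real.sinh (l * u t * B)) :=
          h1.trans (Finset.prod_le_prod (fun t _ => (Real.exp_pos _).le) fun t _ => hω t)
        rw [← ENNReal.ofReal_prod_of_nonneg fun t _ => (Real.exp_pos _).le.trans (hω t),
          ← ENNReal.ofReal_mul (Real.exp_pos _).le, ← ENNReal.ofReal_one]
        refine ENNReal.ofReal_le_ofReal ?_
        calc (1 : ℝ) = Real.exp (-(l * s)) * Real.exp (l * s) := by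
              rw [← Real.exp_add]; simp
          _ ≤ _ := mul_le_mul_of_nonneg_left h2 (Real.exp_pos _).le
    _ ≤ ∫⁻ ω in (fun ω t => Z t ω) ⁻¹' S,
          ENNReal.ofReal (Real.exp (-(l * s))) * ∏ t, φ t (Z t ω, e t ω) ∂μ :=
        lintegral_mono_set Set.inter_subset_left
    _ = ENNReal.ofReal (Real.exp (-(l * s))) *
          ((∏ t, ((Real.cosh (l * u t * B)).toNNReal : ℝ≥0∞)) *
            μ ((fun ω t => Z t ω) ⁻¹' S)) := by
        rw [lintegral_const_mul' _ _ ENNReal.ofReal_ne_top, hmain]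
    _ ≤ ENNReal.ofReal (Real.exp (-(l * s))) *
          (ENNReal.ofReal (Real.exp (n * (l ^ 2 * B ^ 2 / 2))) *
            μ ((fun ω t => Z t ω) ⁻¹' S)) := by gcongr
    _ = _ := by
        rw [← mul_assoc, ← ENNReal.ofReal_mul (Real.exp_pos _).le, ← Real.exp_add]
        congr 3
        -- For empty `ι` both exponents vanish, as division by zero gives zero.
        rcases eq_or_ne n 0 with h0 | h0
        · simp [hl, h0]
        · rw [hl]; field_simp; ring

/-- The exponential inequality, uniformly over a countable family of functions of `Z` that
produces at most `N` patterns for each value of `Z`. -/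
lemma measure_exists_pattern_le [IsProbabilityMeasure μ] (Z : ι → Ω → A)
    (e : ι → Ω → ℝ) (hZ : ∀ t, Measurable (Z t)) (he : ∀ t, Measurable (e t))
    (hind : iIndepFun (fun t ω => (Z t ω, e t ω)) μ) {B : ℝ} (hB : 0 < B)
    (hbd : ∀ t, ∀ᵐ ω ∂μ, |e t ω| ≤ B)
    (hmean : ∀ t S, MeasurableSet S → ∫ ω in Z t ⁻¹' S, e t ω ∂μ = 0)
    {κ : Type*} [Countable κ] (Ψ : κ → (ι → A) → ι → ℤ) (hΨ : ∀ i, Measurable (Ψ i))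
    {K N : ℕ} (hΨK : ∀ i z t, Ψ i z t ∈ Finset.Icc (-K : ℤ) K)
    (hN : ∀ z, ∃ P : Finset (ι → ℤ), (∀ i, Ψ i z ∈ P) ∧ P.card ≤ N)
    {s : ℝ} (hs : 0 ≤ s) :
    μ {ω | ∃ i, s ≤ |∑ t, e t ω * ((Ψ i (fun t => Z t ω) t : ℝ) / K)|}
      ≤ 2 * N * ENNReal.ofReal (Real.exp (-(s ^ 2 / (2 * Fintype.card ι * B ^ 2)))) := by
  classical
  set c := ENNReal.ofReal (Real.exp (-(s ^ 2 / (2 * Fintype.card ι * B ^ 2)))) with hc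
  have hZall : Measurable fun ω t => Z t ω := measurable_pi_lambda _ hZ
  let G : Finset (ι → ℤ) := Fintype.piFinset fun _ => Finset.Icc (-K : ℤ) K
  -- The inputs at which the pattern `u` occurs; countability of `κ` makes this set measurable.
  let S : (ι → ℤ) → Set (ι → A) := fun u => ⋃ i, Ψ i ⁻¹' {u}
  have hS : ∀ u, MeasurableSet (S u) := fun u =>
    MeasurableSet.iUnion fun i => hΨ i (measurableSet_singleton u)
  let V : (ι → ℤ) → Set Ω := fun u => (fun ω t => Z t ω) ⁻¹' S u
  have hV : ∀ u, MeasurableSet (V u) := fun u => hZall (hS u)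
  have hsub : {ω | ∃ i, s ≤ |∑ t, e t ω * ((Ψ i (fun t => Z t ω) t : ℝ) / K)|}
      ⊆ ⋃ u ∈ G, (V u ∩ {ω | s ≤ ∑ t, e t ω * ((u t : ℝ) / K)}) ∪
        (V u ∩ {ω | s ≤ ∑ t, e t ω * (-((u t : ℝ) / K))}) := by
    rintro ω ⟨i, hi⟩
    simp only [Set.mem_iUnion]
    refine ⟨Ψ i (fun t => Z t ω), Fintype.mem_piFinset.2 fun t => hΨK i _ t, ?_⟩
    have hmem : ω ∈ V (Ψ i fun t => Z t ω) := Set.mem_iUnion.2 ⟨i, rfl⟩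
    rcases le_abs.1 hi with h | h
    · exact Or.inl ⟨hmem, h⟩
    · refine Or.inr ⟨hmem, ?_⟩
      simpa only [Set.mem_ofPred_eq, mul_neg, Finset.sum_neg_distrib] using h
  have hone : ∀ u ∈ G, μ ((V u ∩ {ω | s ≤ ∑ t, e t ω * ((u t : ℝ) / K)}) ∪
        (V u ∩ {ω | s ≤ ∑ t, e t ω * (-((u t : ℝ) / K))})) ≤ 2 * c * μ (V u) := by
    intro u hu
    have hu' : ∀ t, |(u t : ℝ) / K| ≤ 1 := by
      intro t
      have h := Finset.mem_Icc.1 (Fintype.mem_piFinset.1 hu t)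
      rw [abs_div, Nat.abs_cast]
      refine div_le_one_of_le₀ (abs_le.2 ⟨?_, ?_⟩) K.cast_nonneg
      · exact_mod_cast h.1
      · exact_mod_cast h.2
    refine (measure_union_le _ _).trans ?_
    have h₁ := measure_inter_le_exp_mul Z e hZ he hind hB hbd hmean
      (fun t => (u t : ℝ) / K) hu' (hS u) hs
    have h₂ := measure_inter_le_exp_mul Z e hZ he hind hB hbd hmean
      (fun t => -((u t : ℝ) / K)) (fun t => by rw [abs_neg]; exact hu' t) (hS u) hs
    calc _ ≤ c * μ (V u) + c * μ (V u) := add_le_add h₁ h₂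
      _ = _ := by ring
  -- The sum is the expected number of patterns that occur, and at most `N` occur for each value of
  -- the inputs. The union bound thus costs `N` and not the size of the whole grid `G`.
  have hsum : ∑ u ∈ G, μ (V u) ≤ N := by
    have : ∑ u ∈ G, μ (V u) = ∫⁻ ω, ∑ u ∈ G, (V u).indicator 1 ω ∂μ := by
      rw [lintegral_finsetSum _ fun u _ => measurable_one.indicator (hV u)]
      exact Finset.sum_congr rfl fun u _ => (lintegral_indicator_one (hV u)).symm
    rw [this]
    calc _ ≤ ∫⁻ _ω, (N : ℝ≥0∞) ∂μ := by
          refine lintegral_mono fun ω => ?_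
          obtain ⟨P, hP, hcard⟩ := hN fun t => Z t ω
          calc ∑ u ∈ G, (V u).indicator (1 : Ω → ℝ≥0∞) ω
              ≤ ∑ u ∈ G, if u ∈ P then 1 else 0 := by
                refine Finset.sum_le_sum fun u _ => ?_
                by_cases h : ω ∈ V u
                · obtain ⟨i, hi⟩ := Set.mem_iUnion.1 h
                  have : u ∈ P := by
                    have := hP i
                    rwa [show Ψ i (fun t => Z t ω) = u from hi] at this
                  rw [if_pos this]
                  exact Set.indicator_le_self' (fun _ _ => zero_le) ω
                · simp [h]
            _ = ((G.filter (· ∈ P)).card : ℝ≥0∞) := by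
                rw [Finset.sum_boole]
            _ ≤ (N : ℝ≥0∞) := by
                refine Nat.cast_le.2 (le_trans (Finset.card_le_card fun u hu => ?_) hcard)
                exact (Finset.mem_filter.1 hu).2
      _ = N := by simp
  calc _ ≤ _ := measure_mono hsub
    _ ≤ _ := measure_biUnion_finset_le _ _
    _ ≤ ∑ u ∈ G, 2 * c * μ (V u) := Finset.sum_le_sum hone
    _ = 2 * c * ∑ u ∈ G, μ (V u) := (Finset.mul_sum _ _ _).symm
    _ ≤ 2 * c * N := by gcongr
    _ = _ := by ring

end Exponential

/-! ### Truncated noise and the deviation of the units -/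

/-- Noise with conditional mean zero given `Z` is, up to an error of size `v / B` in mean, a
bounded function of `Z` and the noise with conditional mean zero given `Z`. -/
lemma exists_centred_truncation {Ω A : Type*} [MeasurableSpace Ω] [MeasurableSpace A]
    {μ : Measure Ω} [IsProbabilityMeasure μ] {Z : Ω → A} (hZ : Measurable Z) {ε : Ω → ℝ}
    (hε : Measurable ε) (hL2 : MemLp ε 2 μ)
    (hcm : μ[ε | MeasurableSpace.comap Z inferInstance] =ᵐ[μ] 0) {B : ℝ} (hB : 0 < B) :
    ∃ τ : A × ℝ → ℝ, Measurable τ ∧ (∀ᵐ ω ∂μ, |τ (Z ω, ε ω)| ≤ 2 * B) ∧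
      (∀ S, MeasurableSet S → ∫ ω in Z ⁻¹' S, τ (Z ω, ε ω) ∂μ = 0) ∧
      Integrable (fun ω => |ε ω - τ (Z ω, ε ω)|) μ ∧
      ∫ ω, |ε ω - τ (Z ω, ε ω)| ∂μ ≤ 2 * (∫ ω, ε ω ^ 2 ∂μ) / B := by
  classical
  have hm : MeasurableSpace.comap Z inferInstance ≤ (inferInstance : MeasurableSpace Ω) :=
    hZ.comap_le
  have hint : Integrable ε μ := hL2.integrable (by norm_num)
  let tail : ℝ → ℝ := fun x => if |x| ≤ B then 0 else x
  have htail : Measurable tail :=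
    Measurable.ite (measurableSet_le measurable_id.abs measurable_const) measurable_const
      measurable_id
  have htail_le : ∀ x, |tail x| ≤ x ^ 2 / B := by
    intro x
    by_cases h : |x| ≤ B
    · simp only [tail, if_pos h, abs_zero]; positivity
    · simp only [tail, if_neg h]
      rw [le_div_iff₀ hB, ← sq_abs]
      nlinarith [abs_nonneg x, not_le.1 h]
  have htrunc_le : ∀ x, |x - tail x| ≤ B := by
    intro x
    by_cases h : |x| ≤ B
    · simpa only [tail, if_pos h, sub_zero] using h
    · simp only [tail, if_neg h, sub_self, abs_zero]; exact hB.le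
  have hint2 : Integrable (fun ω => ε ω ^ 2 / B) μ := hL2.integrable_sq.div_const B
  have hitail : Integrable (fun ω => tail (ε ω)) μ :=
    hint2.mono' (htail.comp hε).aestronglyMeasurable (ae_of_all _ fun ω => htail_le _)
  -- As `ε` is conditionally centred, its truncation `ε - tail ε` has conditional mean `-c`; adding
  -- `c` recentres it. Being a function of `Z`, the correction keeps `τ` a function of the pair `(Z,
  -- ε)`, so independence across observations survives.
  let c : Ω → ℝ := μ[fun ω => tail (ε ω) | MeasurableSpace.comap Z inferInstance]
  obtain ⟨h, hh, hcomp⟩ : ∃ h : A → ℝ, StronglyMeasurable h ∧ c = h ∘ Z :=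
    StronglyMeasurable.exists_eq_measurable_comp stronglyMeasurable_condExp
  have hic : Integrable c μ := integrable_condExp
  have hτ : ∀ ω, ε ω - tail (ε ω) + h (Z ω) = ε ω - tail (ε ω) + c ω := fun ω => by
    rw [hcomp]; rfl
  have hsub : ∀ ω, |ε ω - (ε ω - tail (ε ω) + c ω)| = |tail (ε ω) - c ω| := fun ω => by
    congr 1; ring
  refine ⟨fun x => x.2 - tail x.2 + h x.1, ?_, ?_, ?_, ?_, ?_⟩
  · exact (measurable_snd.sub (htail.comp measurable_snd)).add
      (hh.measurable.comp measurable_fst)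
  · have h₁ := ae_bdd_abs_condExp_of_ae_bdd_abs (μ := μ) (m := MeasurableSpace.comap Z inferInstance)
      (R := B) (f := fun ω => ε ω - tail (ε ω))
      (ae_of_all _ fun ω => htrunc_le _)
    have h₂ := condExp_sub hint hitail (MeasurableSpace.comap Z inferInstance)
    filter_upwards [h₁, h₂, hcm] with ω hω₁ hω₂ hω₃
    have hω₂' : (μ[fun ω => ε ω - tail (ε ω) | MeasurableSpace.comap Z inferInstance]) ω
        = (μ[ε | MeasurableSpace.comap Z inferInstance]) ω - c ω := hω₂
    rw [hω₂', hω₃, Pi.zero_apply, zero_sub, abs_neg] at hω₁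
    rw [hτ]
    calc |ε ω - tail (ε ω) + c ω| ≤ |ε ω - tail (ε ω)| + |c ω| := abs_add_le _ _
      _ ≤ 2 * B := by linarith [htrunc_le (ε ω)]
  · intro S hS
    have hS' : MeasurableSet[MeasurableSpace.comap Z inferInstance] (Z ⁻¹' S) := ⟨S, hS, rfl⟩
    have h₁ : ∫ ω in Z ⁻¹' S, c ω ∂μ = ∫ ω in Z ⁻¹' S, tail (ε ω) ∂μ :=
      setIntegral_condExp hm hitail hS'
    have h₂ : ∫ ω in Z ⁻¹' S, ε ω ∂μ = 0 := by
      rw [← setIntegral_condExp hm hint hS', setIntegral_congr_ae (g := fun _ => (0 : ℝ)) (hm _ hS')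
        (hcm.mono fun ω hω _ => hω), integral_zero]
    simp only [hτ]
    rw [integral_add (f := fun ω => ε ω - tail (ε ω)) (hint.sub hitail).integrableOn
      hic.integrableOn, integral_sub hint.integrableOn hitail.integrableOn, h₁, h₂]
    ring
  · simp only [hτ, hsub]
    exact (hitail.sub hic).abs
  · simp only [hτ, hsub]
    have h₁ : ∫ ω, |tail (ε ω)| ∂μ ≤ (∫ ω, ε ω ^ 2 ∂μ) / B := by
      rw [← integral_div]
      exact integral_mono hitail.abs hint2 fun ω => htail_le _
    have h₂ : ∫ ω, |c ω| ∂μ ≤ ∫ ω, |tail (ε ω)| ∂μ := integral_abs_condExp_le _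
    calc ∫ ω, |tail (ε ω) - c ω| ∂μ ≤ ∫ ω, (|tail (ε ω)| + |c ω|) ∂μ :=
          integral_mono (hitail.sub hic).abs (hitail.abs.add hic.abs) fun ω => abs_sub _ _
      _ = ∫ ω, |tail (ε ω)| ∂μ + ∫ ω, |c ω| ∂μ := integral_add hitail.abs hic.abs
      _ ≤ (∫ ω, ε ω ^ 2 ∂μ) / B + (∫ ω, ε ω ^ 2 ∂μ) / B := by linarith
      _ = _ := by ring

/-- Deviation of square-integrable noise, uniformly over a countable family of functions of `Z`
that are within `δ` of at most `N` quantised patterns. -/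
lemma measure_exists_deviation_le {Ω A ι : Type*} [MeasurableSpace Ω] [MeasurableSpace A]
    [Fintype ι] [Nonempty ι] {μ : Measure Ω} [IsProbabilityMeasure μ] (Z : ι → Ω → A)
    (ε : ι → Ω → ℝ) (hZ : ∀ t, Measurable (Z t)) (hε : ∀ t, Measurable (ε t))
    (hind : iIndepFun (fun t ω => (Z t ω, ε t ω)) μ) (hL2 : ∀ t, MemLp (ε t) 2 μ)
    (hcm : ∀ t, μ[ε t | MeasurableSpace.comap (Z t) inferInstance] =ᵐ[μ] 0)
    {v : ℝ} (hvar : ∀ t, ∫ ω, ε t ω ^ 2 ∂μ = v)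
    {κ : Type*} [Countable κ] (U : κ → (ι → A) → ι → ℝ) (hU : ∀ i z t, |U i z t| ≤ 1)
    (Ψ : κ → (ι → A) → ι → ℤ) (hΨ : ∀ i, Measurable (Ψ i))
    {K N : ℕ} (hΨK : ∀ i z t, Ψ i z t ∈ Finset.Icc (-K : ℤ) K)
    (hN : ∀ z, ∃ P : Finset (ι → ℤ), (∀ i, Ψ i z ∈ P) ∧ P.card ≤ N)
    {δ : ℝ} (hδ : ∀ i z t, |U i z t - Ψ i z t / K| ≤ δ)
    {a B : ℝ} (ha : 0 < a) (hB : 0 < B) :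
    μ {ω | ∃ i, Fintype.card ι * (2 * a + 2 * B * δ) <
        |∑ t, ε t ω * U i (fun t => Z t ω) t|}
      ≤ ENNReal.ofReal (2 * v / (B * a)) +
        2 * N * ENNReal.ofReal (Real.exp (-(Fintype.card ι * a ^ 2 / (8 * B ^ 2)))) := by
  set n : ℝ := (Fintype.card ι : ℝ) with hn
  have hn0 : 0 < n := Nat.cast_pos.2 Fintype.card_pos
  choose τ hτ hbd hmean hi hL1 using fun t =>
    exists_centred_truncation (hZ t) (hε t) (hL2 t) (hcm t) hB
  let e : ι → Ω → ℝ := fun t ω => τ t (Z t ω, ε t ω)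
  have he : ∀ t, Measurable (e t) := fun t => (hτ t).comp ((hZ t).prodMk (hε t))
  have hind' : iIndepFun (fun t ω => (Z t ω, e t ω)) μ :=
    hind.comp (fun t x => (x.1, τ t x)) fun t => measurable_fst.prodMk (hτ t)
  have h₁ := measure_exists_pattern_le Z e hZ he hind' (show 0 < 2 * B by linarith) hbd hmean
    Ψ hΨ hΨK hN (s := n * a) (by positivity)
  have hexp : (n * a) ^ 2 / (2 * n * (2 * B) ^ 2) = n * a ^ 2 / (8 * B ^ 2) := by
    field_simp; ring
  rw [← hn, hexp] at h₁
  have hisum : Integrable (fun ω => ∑ t, |ε t ω - e t ω|) μ := integrable_finsetSum _ fun t _ => hi t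
  -- Markov's inequality for the total L¹ truncation error, whose mean is at most `n * (2 * v / B)`.
  have h₂ : μ {ω | n * a ≤ ∑ t, |ε t ω - e t ω|} ≤ ENNReal.ofReal (2 * v / (B * a)) := by
    have hmk := mul_meas_ge_le_integral_of_nonneg
      (ae_of_all μ fun ω => Finset.sum_nonneg fun t (_ : t ∈ Finset.univ) =>
        abs_nonneg (ε t ω - e t ω)) hisum (n * a)
    have hle : ∫ ω, ∑ t, |ε t ω - e t ω| ∂μ ≤ n * (2 * v / B) := by
      rw [integral_finsetSum _ fun t _ => hi t]
      calc _ ≤ ∑ _t : ι, 2 * v / B := Finset.sum_le_sum fun t _ => by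
            have := hL1 t; rwa [hvar t] at this
        _ = _ := by simp [hn]
    have hreal : μ.real {ω | n * a ≤ ∑ t, |ε t ω - e t ω|} ≤ 2 * v / (B * a) := by
      have h := hmk.trans hle
      rw [mul_comm, ← le_div_iff₀ (by positivity)] at h
      refine h.trans_eq ?_
      field_simp
    rw [← ENNReal.ofReal_toReal (measure_ne_top μ {ω | n * a ≤ ∑ t, |ε t ω - e t ω|})]
    exact ENNReal.ofReal_le_ofReal hreal
  have hsub : {ω | ∃ i, n * (2 * a + 2 * B * δ) < |∑ t, ε t ω * U i (fun t => Z t ω) t|}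
      ≤ᵐ[μ] ({ω | n * a ≤ ∑ t, |ε t ω - e t ω|} ∪
        {ω | ∃ i, n * a ≤ |∑ t, e t ω * ((Ψ i (fun t => Z t ω) t : ℝ) / K)|} : Set Ω) := by
    filter_upwards [ae_all_iff.2 hbd] with ω hω
    rintro ⟨i, hlt⟩
    by_contra hnot
    have hnot' : ¬ (n * a ≤ ∑ t, |ε t ω - e t ω|) ∧
        ¬ ∃ i, n * a ≤ |∑ t, e t ω * ((Ψ i (fun t => Z t ω) t : ℝ) / K)| :=
      not_or.1 hnot
    obtain ⟨hno₁, hno₂⟩ := hnot'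
    rw [not_le] at hno₁
    have hno₃ := not_le.1 fun h => hno₂ ⟨i, h⟩
    set z := fun t => Z t ω with hz
    -- Three errors: truncation (`n * a`, by Markov), deviation of the bounded noise along a pattern
    -- (`n * a`, by Hoeffding), and rounding (`n * (2 * B * δ)`, deterministic).
    have hdec : ∑ t, ε t ω * U i z t = ∑ t, (ε t ω - e t ω) * U i z t +
        ∑ t, e t ω * ((Ψ i z t : ℝ) / K) + ∑ t, e t ω * (U i z t - Ψ i z t / K) := by
      rw [← Finset.sum_add_distrib, ← Finset.sum_add_distrib]
      exact Finset.sum_congr rfl fun t _ => by ring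
    have hb₁ : |∑ t, (ε t ω - e t ω) * U i z t| ≤ ∑ t, |ε t ω - e t ω| := by
      refine (Finset.abs_sum_le_sum_abs _ _).trans (Finset.sum_le_sum fun t _ => ?_)
      rw [abs_mul]
      exact mul_le_of_le_one_right (abs_nonneg _) (hU i z t)
    have hb₂ : |∑ t, e t ω * (U i z t - Ψ i z t / K)| ≤ n * (2 * B * δ) := by
      refine (Finset.abs_sum_le_sum_abs _ _).trans ?_
      calc _ ≤ ∑ _t : ι, 2 * B * δ := Finset.sum_le_sum fun t _ => by
            rw [abs_mul]
            exact mul_le_mul (hω t) (hδ i z t) (abs_nonneg _) (by positivity)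
        _ = _ := by simp [hn]
    have habs := abs_add_three (∑ t, (ε t ω - e t ω) * U i z t)
      (∑ t, e t ω * ((Ψ i z t : ℝ) / K)) (∑ t, e t ω * (U i z t - Ψ i z t / K))
    rw [← hdec] at habs
    have hlt' : n * (2 * a + 2 * B * δ) < |∑ t, ε t ω * U i z t| := hlt
    linarith
  calc _ ≤ _ := measure_mono_ae hsub
    _ ≤ _ := measure_union_le _ _
    _ ≤ _ := add_le_add h₂ h₁

/-! ### The units of the second hidden layer -/

/-- Weights of a unit of the first hidden layer. -/
abbrev InnerWeights (p m : ℕ) : Type := (Fin p → Fin m → ℝ) × (Fin m → ℝ) × ℝ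

/-- The affine function of the input that a unit of the first hidden layer applies `tanh` to,
evaluated at the points `z`. -/
noncomputable def innerEval {p m : ℕ} {ι : Type*} (z : ι → Input p m) :
    InnerWeights p m →ₗ[ℝ] ι → ℝ where
  toFun w t := (∑ k, ∑ l, w.1 k l * (z t).2.1 l k) + (∑ l, w.2.1 l * (z t).2.2 l) + w.2.2
  map_add' v w := by
    ext t
    simp only [Prod.fst_add, Prod.snd_add, Pi.add_apply, add_mul, Finset.sum_add_distrib]
    ring
  map_smul' c w := by
    ext t
    simp only [Prod.smul_fst, Prod.smul_snd, Pi.smul_apply, smul_eq_mul, RingHom.id_apply,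
      mul_add, Finset.mul_sum, mul_assoc]

/-- Weights of a unit of the second hidden layer, with `ℓ¹` norm at most `V` in that layer. -/
abbrev UnitWeights (p m r : ℕ) (V : ℝ) : Type :=
  {w : (Fin r → InnerWeights p m) × (Fin r → ℝ) × ℝ // |w.2.2| + ∑ j, |w.2.1 j| ≤ V}

/-- The output of a unit of the second hidden layer. -/
noncomputable def UnitWeights.eval {p m r : ℕ} {V : ℝ} (w : UnitWeights p m r V)
    (z : Input p m) : ℝ :=
  Real.tanh (∑ j, w.1.2.1 j * Real.tanh ((∑ k, ∑ l, (w.1.1 j).1 k l * z.2.1 l k) +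
    (∑ l, (w.1.1 j).2.1 l * z.2.2 l) + (w.1.1 j).2.2) + w.1.2.2)

/-- The unit with both layers quantised. -/
noncomputable def UnitWeights.cell {p m r : ℕ} {V : ℝ} (K : ℕ) (w : UnitWeights p m r V)
    (z : Input p m) : ℤ :=
  tanhCell K (∑ j, w.1.2.1 j * (tanhCell K ((∑ k, ∑ l, (w.1.1 j).1 k l * z.2.1 l k) +
    (∑ l, (w.1.1 j).2.1 l * z.2.2 l) + (w.1.1 j).2.2) / K) + w.1.2.2)

lemma UnitWeights.continuous_eval {p m r : ℕ} {V : ℝ} (z : Input p m) :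
    Continuous fun w : UnitWeights p m r V => w.eval z := by
  unfold UnitWeights.eval
  refine continuous_tanh.comp (Continuous.add (continuous_finsetSum _ fun j _ =>
    Continuous.mul (by fun_prop) (continuous_tanh.comp (by fun_prop))) (by fun_prop))

lemma UnitWeights.measurable_cell {p m r : ℕ} {V : ℝ} (K : ℕ) (w : UnitWeights p m r V) :
    Measurable (w.cell K) := by
  unfold UnitWeights.cell
  refine (measurable_tanhCell K).comp (Measurable.add (Finset.measurable_sum _ fun j _ =>
    Measurable.const_mul (Measurable.div_const (measurable_from_top.comp
      ((measurable_tanhCell K).comp ?_)) _) _) measurable_const)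
  fun_prop

/-- Rounding the first layer moves the argument of the outer `tanh`, which is 1-Lipschitz, by at
most `V / K` through the ℓ¹ bound. Rounding the second layer adds `1 / K ≤ V / K`. -/
lemma UnitWeights.abs_eval_sub_cell_le {p m r : ℕ} {V : ℝ} (hV : 1 ≤ V) {K : ℕ} (hK : 0 < K)
    (w : UnitWeights p m r V) (z : Input p m) :
    |w.eval z - w.cell K z / K| ≤ 2 * V / K := by
  have hK' : (0 : ℝ) < K := Nat.cast_pos.2 hK
  set y : Fin r → ℝ := fun j => (∑ k, ∑ l, (w.1.1 j).1 k l * z.2.1 l k) +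
    (∑ l, (w.1.1 j).2.1 l * z.2.2 l) + (w.1.1 j).2.2 with hy
  set h : ℝ := ∑ j, w.1.2.1 j * Real.tanh (y j) + w.1.2.2 with hh
  set h' : ℝ := ∑ j, w.1.2.1 j * (tanhCell K (y j) / K) + w.1.2.2 with hh'
  have h₁ : |h - h'| ≤ V / K := by
    have : h - h' = ∑ j, w.1.2.1 j * (Real.tanh (y j) - tanhCell K (y j) / K) := by
      simp only [hh, hh', mul_sub, Finset.sum_sub_distrib]; ring
    rw [this]
    calc _ ≤ ∑ j, |w.1.2.1 j * (Real.tanh (y j) - tanhCell K (y j) / K)| :=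
          Finset.abs_sum_le_sum_abs _ _
      _ ≤ ∑ j, |w.1.2.1 j| * (1 / K) := Finset.sum_le_sum fun j _ => by
          rw [abs_mul]
          exact mul_le_mul_of_nonneg_left (abs_tanh_sub_tanhCell_le hK _) (abs_nonneg _)
      _ = (∑ j, |w.1.2.1 j|) * (1 / K) := (Finset.sum_mul _ _ _).symm
      _ ≤ V * (1 / K) := by
          refine mul_le_mul_of_nonneg_right ?_ (by positivity)
          linarith [w.2, abs_nonneg w.1.2.2]
      _ = V / K := by ring
  have h₂ := abs_tanh_sub_tanhCell_le hK h'
  have h₃ := abs_tanh_sub_le h h'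
  have h₄ : 1 / (K : ℝ) ≤ V / K := by gcongr
  change |Real.tanh h - tanhCell K h' / K| ≤ _
  calc _ ≤ |Real.tanh h - Real.tanh h'| + |Real.tanh h' - tanhCell K h' / K| :=
        abs_sub_le _ _ _
    _ ≤ V / K + V / K := by linarith
    _ = _ := by ring

/-- Deviation of square-integrable noise, uniformly over the units of the second layer. -/
lemma measure_exists_unit_deviation_le {Ω : Type*} [MeasurableSpace Ω] {μ : Measure Ω}
    [IsProbabilityMeasure μ] {p m n : ℕ} (hn : 0 < n) (Z : Fin n → Ω → Input p m)
    (ε : Fin n → Ω → ℝ) (hZ : ∀ t, Measurable (Z t)) (hε : ∀ t, Measurable (ε t))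
    (hind : iIndepFun (fun t ω => (Z t ω, ε t ω)) μ) (hL2 : ∀ t, MemLp (ε t) 2 μ)
    (hcm : ∀ t, μ[ε t | MeasurableSpace.comap (Z t) inferInstance] =ᵐ[μ] 0)
    {v : ℝ} (hvar : ∀ t, ∫ ω, ε t ω ^ 2 ∂μ = v) (r : ℕ) {V : ℝ} (hV : 1 ≤ V) {K : ℕ}
    (hK : 0 < K) {a B : ℝ} (ha : 0 < a) (hB : 0 < B) :
    μ {ω | ∃ w : UnitWeights p m r V, n * (2 * a + 4 * B * V / K) <
        |∑ t, ε t ω * w.eval (Z t ω)|}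
      ≤ ENNReal.ofReal (2 * v / (B * a)) +
        2 * ENNReal.ofReal ((n + 1) ^ (((p * m + m + 1) * r + (r + 1)) * (2 * K)) *
          Real.exp (-(n * a ^ 2 / (8 * B ^ 2)))) := by
  have : Nonempty (Fin n) := ⟨⟨0, hn⟩⟩
  -- A countable dense set of weights suffices: for fixed data the strict deviation inequality is an
  -- open condition on the weights. Only `eval` has to be continuous for this, not the rounded
  -- `cell`.
  obtain ⟨s, hs, hdense⟩ := TopologicalSpace.exists_countable_dense (UnitWeights p m r V)
  have : Countable s := hs.to_subtype
  have h := measure_exists_deviation_le Z ε hZ hε hind hL2 hcm hvar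
    (κ := s) (fun w z t => w.1.eval (z t)) (fun w z t => (Real.abs_tanh_lt_one _).le)
    (fun w z t => w.1.cell K (z t))
    (fun w => measurable_pi_lambda _ fun t =>
      (w.1.measurable_cell K).comp (measurable_pi_apply t))
    (K := K) (N := (n + 1) ^ (((p * m + m + 1) * r + (r + 1)) * (2 * K)))
    (fun w z t => tanhCell_mem_Icc _ _)
    (fun z => by
      obtain ⟨P, hP, hcard⟩ := exists_card_two_layer_patterns_le (innerEval z)
        ⟨(0, 0, 1), fun t => by simp [innerEval]⟩ K r
      refine ⟨P, fun w => hP w.1.1.1 w.1.1.2.1 w.1.1.2.2, hcard.trans_eq ?_⟩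
      have hfin : Module.finrank ℝ (InnerWeights p m) = p * m + m + 1 := by
        simp [Module.finrank_pi_fintype]
        ring
      rw [hfin, Fintype.card_fin])
    (fun w z t => w.1.abs_eval_sub_cell_le hV hK (z t)) ha hB
  rw [Fintype.card_fin] at h
  refine (measure_mono ?_).trans (h.trans_eq ?_)
  · rintro ω ⟨w, hw⟩
    have hopen : IsOpen {w : UnitWeights p m r V |
        n * (2 * a + 4 * B * V / K) < |∑ t, ε t ω * w.eval (Z t ω)|} :=
      isOpen_lt continuous_const (continuous_finsetSum _ fun t _ =>
        continuous_const.mul (UnitWeights.continuous_eval (Z t ω))).abs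
    obtain ⟨w', hw', hmem⟩ := hdense.exists_mem_open hopen ⟨w, hw⟩
    refine ⟨⟨w', hw'⟩, lt_of_eq_of_lt ?_ hmem⟩
    ring
  · rw [ENNReal.ofReal_mul (by positivity), mul_assoc]
    congr 3
    rw [← ENNReal.ofReal_natCast]
    push_cast
    rfl

/-! ### Noise is asymptotically orthogonal to the sieve -/

lemma half_le_tanh {x : ℝ} (hx : 1 ≤ x) : 1 / 2 ≤ Real.tanh x := by
  refine le_trans ?_ (strictMono_tanh.monotone hx)
  have h₁ := Real.exp_one_gt_d9
  have h₂ : Real.exp 1 * Real.exp (-1) = 1 := by rw [← Real.exp_add]; simp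
  rw [Real.tanh_eq, div_le_div_iff₀ two_pos (by positivity)]
  nlinarith [Real.exp_pos (-1)]

/-- By `ℓ¹` duality, a bound for all units of the second layer bounds all networks. -/
lemma abs_sum_mul_network_le {p m r : ℕ} {V₁ V₂ : ℝ} (hV₂ : 1 ≤ V₂) {ι : Type*} [Fintype ι]
    (z : ι → Input p m) (ε : ι → ℝ) {c : ℝ}
    (hc : ∀ w : UnitWeights p m r V₂, |∑ t, ε t * w.eval (z t)| ≤ c)
    {f : Input p m → ℝ} (hf : f ∈ networks p m r V₁ V₂) :
    |∑ t, ε t * f (z t)| ≤ 2 * V₂ * c := by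
  obtain ⟨w, ⟨hout, hmid, -⟩, rfl⟩ := hf
  let unit : Fin r → UnitWeights p m r V₂ := fun i =>
    ⟨(fun j => (w.inX i j, w.inY i j, w.inBias i j), w.mid i, w.midBias i), hmid i⟩
  -- The output bias multiplies the constant function 1, which is not a unit. The unit with zero
  -- weights and bias `V₂` is the constant `tanh V₂ ≥ 1 / 2`, whence the factor 2.
  have hconst : |∑ t, ε t| ≤ 2 * c := by
    let w₀ : UnitWeights p m r V₂ := ⟨(0, 0, V₂), by
      simp [abs_of_nonneg (zero_le_one.trans hV₂)]⟩
    have h := hc w₀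
    have hev : ∀ t, w₀.eval (z t) = Real.tanh V₂ := fun t => by
      simp [UnitWeights.eval, w₀]
    simp only [hev] at h
    rw [← Finset.sum_mul, abs_mul] at h
    have h₁ := half_le_tanh hV₂
    rw [abs_of_nonneg (show 0 ≤ Real.tanh V₂ by linarith)] at h
    nlinarith [abs_nonneg (∑ t, ε t)]
  have hc0 : 0 ≤ c := by linarith [abs_nonneg (∑ t, ε t)]
  have hdec : ∑ t, ε t * w.eval (z t) = w.outBias * ∑ t, ε t +
      ∑ i, w.out i * ∑ t, ε t * (unit i).eval (z t) := by
    simp only [Finset.mul_sum]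
    rw [Finset.sum_comm, ← Finset.sum_add_distrib]
    refine Finset.sum_congr rfl fun t _ => ?_
    rw [Weights.eval, mul_add, Finset.mul_sum, mul_comm]
    congr 1
    exact Finset.sum_congr rfl fun i _ => mul_left_comm _ _ _
  rw [hdec]
  calc _ ≤ |w.outBias * ∑ t, ε t| + |∑ i, w.out i * ∑ t, ε t * (unit i).eval (z t)| :=
        abs_add_le _ _
    _ ≤ |w.outBias| * (2 * c) + ∑ i, |w.out i| * (2 * c) := by
        refine add_le_add ?_ ((Finset.abs_sum_le_sum_abs _ _).trans
          (Finset.sum_le_sum fun i _ => ?_))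
        · rw [abs_mul]; exact mul_le_mul_of_nonneg_left hconst (abs_nonneg _)
        · rw [abs_mul]
          exact mul_le_mul_of_nonneg_left ((hc (unit i)).trans (by linarith)) (abs_nonneg _)
    _ = (|w.outBias| + ∑ i, |w.out i|) * (2 * c) := by rw [add_mul, Finset.sum_mul]
    _ ≤ V₂ * (2 * c) := mul_le_mul_of_nonneg_right hout (by linarith)
    _ = _ := by ring

/-- Entropy against concentration: the logarithm of the pattern count is at most `4 * (p + 4) * y *
x ^ 7 ≤ y * x ^ 8 / 16`, at most half of the Hoeffding exponent `y * x ^ 10 / 8`. The remaining half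
exceeds `x`. -/
lemma pow_mul_exp_neg_le {p m r K n : ℕ} {x y : ℝ} (hm : 0 < m) (hx : 1 ≤ x) (hy : 1 ≤ y)
    (hmr : m * r ≤ y) (hK : K ≤ 2 * x ^ 6) (hlog : Real.log (n + 1) ≤ x)
    (hp : 64 * (p + 4) ≤ x) :
    ((n : ℝ) + 1) ^ (((p * m + m + 1) * r + (r + 1)) * (2 * K)) *
      Real.exp (-(y * x ^ 10 / 8)) ≤ Real.exp (-x) := by
  have hx0 : 0 < x := by linarith
  have hm1 : (1 : ℝ) ≤ m := by exact_mod_cast hm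
  have hr0 : (0 : ℝ) ≤ r := r.cast_nonneg
  have hp0 : (0 : ℝ) ≤ p := p.cast_nonneg
  have hlog0 : 0 ≤ Real.log (n + 1) := Real.log_nonneg (by linarith [n.cast_nonneg (α := ℝ)])
  have hrm : (r : ℝ) ≤ y := by nlinarith
  have hM : (((p * m + m + 1) * r + (r + 1)) * (2 * K) : ℝ) ≤ ((p + 4) * y) * (4 * x ^ 6) := by
    have h₁ : ((p * m + m + 1) * r + (r + 1) : ℝ) ≤ (p + 4) * y := by
      have : (p : ℝ) * (m * r) ≤ p * y := mul_le_mul_of_nonneg_left hmr hp0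
      nlinarith
    exact mul_le_mul h₁ (by linarith) (by positivity) (by positivity)
  have hpow : ((n : ℝ) + 1) ^ (((p * m + m + 1) * r + (r + 1)) * (2 * K))
      = Real.exp ((((p * m + m + 1) * r + (r + 1)) * (2 * K) : ℝ) * Real.log (n + 1)) := by
    rw [mul_comm (_ : ℝ) (Real.log _), ← Real.rpow_def_of_pos (by positivity),
      ← Real.rpow_natCast]
    push_cast
    rfl
  rw [hpow, ← Real.exp_add]
  refine Real.exp_le_exp.2 ?_
  have h₁ : (((p * m + m + 1) * r + (r + 1)) * (2 * K) : ℝ) * Real.log (n + 1)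
      ≤ ((p + 4) * y) * (4 * x ^ 6) * x :=
    mul_le_mul hM hlog hlog0 (by positivity)
  have h₂ : ((p + 4) * y) * (4 * x ^ 6) * x ≤ y * x ^ 8 / 16 := by
    have : 64 * ((p : ℝ) + 4) * (y * x ^ 7) ≤ x * (y * x ^ 7) :=
      mul_le_mul_of_nonneg_right hp (by positivity)
    nlinarith
  have h₃ : y * x ^ 8 ≤ y * x ^ 10 :=
    mul_le_mul_of_nonneg_left (pow_le_pow_right₀ hx (by norm_num)) (by linarith)
  have h₄ : x * x ≤ y * x ^ 10 := by
    calc x * x = 1 * x ^ 2 := by ring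
      _ ≤ y * x ^ 10 :=
        mul_le_mul hy (pow_le_pow_right₀ hx (by norm_num)) (by positivity) (by linarith)
  have h₅ : 64 * x ≤ x * x := by nlinarith
  linarith

/-- The deviation bound for networks, in terms of a scale `x` with `n = y * x ^ 20`. -/
lemma measure_exists_network_deviation_le {Ω : Type*} [MeasurableSpace Ω] {μ : Measure Ω}
    [IsProbabilityMeasure μ] {p m n : ℕ} (hm : 0 < m) (hn : 0 < n) (Z : ℕ → Ω → Input p m)
    (ε : ℕ → Ω → ℝ) (hZ : ∀ t, Measurable (Z t)) (hε : ∀ t, Measurable (ε t))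
    (hind : iIndepFun (fun t ω => (Z t ω, ε t ω)) μ) (hL2 : ∀ t, MemLp (ε t) 2 μ)
    (hcm : ∀ t, μ[ε t | MeasurableSpace.comap (Z t) inferInstance] =ᵐ[μ] 0)
    {v : ℝ} (hvar : ∀ t, ∫ ω, ε t ω ^ 2 ∂μ = v) {r : ℕ} {V₁ V₂ : ℝ} (hV₂ : 1 ≤ V₂) {x y : ℝ}
    (hx : 1 ≤ x) (hy : 1 ≤ y) (hnxy : (n : ℝ) = y * x ^ 20) (hmr : m * r ≤ y)
    (hVx : V₂ ≤ x) (hlog : Real.log (n + 1) ≤ x) (hp : 64 * (p + 4) ≤ x) :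
    μ {ω | ∃ f ∈ networks p m r V₁ V₂,
        12 * x⁻¹ < (n : ℝ)⁻¹ * |∑ t ∈ Finset.range n, ε t ω * f (Z t ω)|}
      ≤ ENNReal.ofReal (2 * v * x⁻¹) + 2 * ENNReal.ofReal (Real.exp (-x)) := by
  have hx0 : 0 < x := by linarith
  have hn' : (0 : ℝ) < n := Nat.cast_pos.2 hn
  set K : ℕ := ⌈x ^ 6⌉₊ with hKdef
  have hK₁ : x ^ 6 ≤ K := Nat.le_ceil _
  have hx6 : 1 ≤ x ^ 6 := one_le_pow₀ hx
  have hK₂ : (K : ℝ) ≤ 2 * x ^ 6 := by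
    have := Nat.ceil_lt_add_one (show 0 ≤ x ^ 6 by positivity)
    linarith
  have hK0 : 0 < K := Nat.ceil_pos.2 (by positivity)
  have hK0' : (0 : ℝ) < K := Nat.cast_pos.2 hK0
  -- With `a = x⁻²`, `B = x³` and `K ≈ x⁶`, the truncation probability is `2 * v / x`, the Hoeffding
  -- exponent is `n * a² / (8 * B²) = y * x ^ 10 / 8`, and the deviation for networks is at most `2
  -- * x * (2 * x⁻² + 4 * x⁻²) = 12 / x`.
  have h := measure_exists_unit_deviation_le hn (fun t : Fin n => Z t) (fun t => ε t)
    (fun t => hZ t) (fun t => hε t) (hind.precomp Fin.val_injective) (fun t => hL2 t)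
    (fun t => hcm t) (fun t => hvar t) r hV₂ hK0 (a := (x ^ 2)⁻¹) (B := x ^ 3)
    (by positivity) (by positivity)
  have hexp : (n : ℝ) * ((x ^ 2)⁻¹) ^ 2 / (8 * (x ^ 3) ^ 2) = y * x ^ 10 / 8 := by
    rw [hnxy]; field_simp
  have hv : 2 * v / (x ^ 3 * (x ^ 2)⁻¹) = 2 * v * x⁻¹ := by field_simp
  rw [hexp, hv] at h
  refine (measure_mono ?_).trans (h.trans (add_le_add_right (mul_le_mul_right
    (ENNReal.ofReal_le_ofReal (pow_mul_exp_neg_le hm hx hy hmr hK₂ hlog hp)) _) _))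
  rintro ω ⟨f, hf, hlt⟩
  by_contra hnot
  have hall : ∀ w : UnitWeights p m r V₂, |∑ t : Fin n, ε t ω * w.eval (Z t ω)|
      ≤ n * (2 * (x ^ 2)⁻¹ + 4 * x ^ 3 * V₂ / K) := fun w => not_lt.1 fun h => hnot ⟨w, h⟩
  have h₁ := abs_sum_mul_network_le hV₂ (fun t : Fin n => Z t ω) (fun t => ε t ω) hall hf
  rw [Finset.sum_range] at hlt
  have h₂ : (n : ℝ)⁻¹ * |∑ t : Fin n, ε t ω * f (Z t ω)|
      ≤ 2 * V₂ * (2 * (x ^ 2)⁻¹ + 4 * x ^ 3 * V₂ / K) := by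
    rw [inv_mul_le_iff₀ hn']
    linarith
  have h₃ : 2 * V₂ * (2 * (x ^ 2)⁻¹ + 4 * x ^ 3 * V₂ / K) ≤ 12 * x⁻¹ := by
    calc 2 * V₂ * (2 * (x ^ 2)⁻¹ + 4 * x ^ 3 * V₂ / K)
        ≤ 2 * x * (2 * (x ^ 2)⁻¹ + 4 * x ^ 3 * x / x ^ 6) := by gcongr
      _ = 12 * x⁻¹ := by field_simp; ring
  linarith

lemma eventually_log_add_one_le_rpow {κ : ℝ} (hκ : 0 < κ) (hκ₁ : κ ≤ 1) :
    ∀ᶠ n : ℕ in atTop, Real.log (n + 1) ≤ (n : ℝ) ^ κ := by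
  have h := (isLittleO_log_rpow_atTop hκ).bound (show (0 : ℝ) < 1 / 2 by norm_num)
  have hcast : Tendsto (fun n : ℕ => (n : ℝ) + 1) atTop atTop :=
    tendsto_atTop_add_const_right _ _ tendsto_natCast_atTop_atTop
  filter_upwards [hcast.eventually h, eventually_ge_atTop 1] with n hn hn1
  have hn1' : (1 : ℝ) ≤ n := by exact_mod_cast hn1
  have h₁ : ((n : ℝ) + 1) ^ κ ≤ 2 * (n : ℝ) ^ κ := by
    calc ((n : ℝ) + 1) ^ κ ≤ (2 * n : ℝ) ^ κ := by gcongr; linarith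
      _ = 2 ^ κ * (n : ℝ) ^ κ := Real.mul_rpow (by norm_num) (by linarith)
      _ ≤ 2 ^ (1 : ℝ) * (n : ℝ) ^ κ := by gcongr; norm_num
      _ = _ := by rw [Real.rpow_one]
  rw [Real.norm_eq_abs, Real.norm_eq_abs, abs_of_nonneg (by positivity : 0 ≤ ((n : ℝ) + 1) ^ κ)]
    at hn
  linarith [le_abs_self (Real.log ((n : ℝ) + 1))]

/-- The correlation of the noise with the networks of the sieve vanishes uniformly. -/
lemma tendsto_measure_exists_network_deviation {Ω : Type*} [MeasurableSpace Ω] {μ : Measure Ω}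
    [IsProbabilityMeasure μ] {p : ℕ} (Γ : ℕ → ℕ) (hΓ : ∀ n, 0 < Γ n)
    (Z : ∀ n, ℕ → Ω → Input p (Γ n)) (ε : ℕ → ℕ → Ω → ℝ) (hZ : ∀ n t, Measurable (Z n t))
    (hε : ∀ n t, Measurable (ε n t))
    (hind : ∀ n, iIndepFun (fun t ω => (Z n t ω, ε n t ω)) μ)
    (hL2 : ∀ n t, MemLp (ε n t) 2 μ)
    (hcm : ∀ n t, μ[ε n t | MeasurableSpace.comap (Z n t) inferInstance] =ᵐ[μ] 0)
    {v : ℝ} (hvar : ∀ n t, ∫ ω, ε n t ω ^ 2 ∂μ = v) (r : ℕ → ℕ) (V₁ V₂ : ℕ → ℝ)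
    (hV₁ : ∀ n, 1 < V₁ n) (hV₂ : ∀ n, 1 < V₂ n) {ψ β : ℝ} (hψβ_pos : 0 < ψ + β)
    (hψβ_lt : ψ + β < 1)
    (hΓ_growth : (fun n => (Γ n : ℝ)) =o[atTop] (fun n : ℕ => (n : ℝ) ^ ψ))
    (hr_growth : (fun n => (r n : ℝ)) =o[atTop] (fun n : ℕ => (n : ℝ) ^ β))
    (hV_growth : (fun n => V₁ n * V₂ n) =o[atTop] (fun n : ℕ => Real.sqrt (Real.log n)))
    {η : ℝ} (hη : 0 < η) :
    Tendsto (fun n => μ {ω | ∃ f ∈ networks p (Γ n) (r n) (V₁ n) (V₂ n),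
      η < (n : ℝ)⁻¹ * |∑ t ∈ Finset.range n, ε n t ω * f (Z n t ω)|}) atTop (𝓝 0) := by
  -- Chosen so that `x = n ^ κ` and `y = n ^ (ψ + β)` satisfy `n = y * x ^ 20`, with `y` dominating
  -- `Γ n * r n` and `x` dominating the logarithmic terms.
  set κ : ℝ := (1 - (ψ + β)) / 20 with hκdef
  have hκ : 0 < κ := by rw [hκdef]; linarith
  have hκ₁ : κ ≤ 1 := by rw [hκdef]; linarith
  have hx : Tendsto (fun n : ℕ => (n : ℝ) ^ κ) atTop atTop :=
    (tendsto_rpow_atTop hκ).comp tendsto_natCast_atTop_atTop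
  have hxinv : Tendsto (fun n : ℕ => ((n : ℝ) ^ κ)⁻¹) atTop (𝓝 0) := tendsto_inv_atTop_zero.comp hx
  have hlim : Tendsto (fun n : ℕ => ENNReal.ofReal (2 * v * ((n : ℝ) ^ κ)⁻¹) +
      2 * ENNReal.ofReal (Real.exp (-((n : ℝ) ^ κ)))) atTop (𝓝 0) := by
    have h₁ := ENNReal.tendsto_ofReal (hxinv.const_mul (2 * v))
    have h₂ := ENNReal.tendsto_ofReal
      (Real.tendsto_exp_atBot.comp (tendsto_neg_atTop_atBot.comp hx))
    have h₃ := h₁.add (ENNReal.Tendsto.const_mul h₂ (Or.inr ENNReal.ofNat_ne_top) (a := 2))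
    simpa using h₃
  refine tendsto_of_tendsto_of_tendsto_of_le_of_le' tendsto_const_nhds hlim
    (Eventually.of_forall fun _ => zero_le) ?_
  filter_upwards [hx.eventually_ge_atTop 1, hx.eventually_ge_atTop (64 * (p + 4)),
    eventually_ge_atTop 1, eventually_log_add_one_le_rpow hκ hκ₁,
    hΓ_growth.bound one_pos, hr_growth.bound one_pos, hV_growth.bound one_pos,
    (hxinv.const_mul 12).eventually_lt_const (show 12 * 0 < η by simpa using hη)]
    with n hx1 hxp hn1 hlog hΓn hrn hVn hηn
  have hn1' : (1 : ℝ) ≤ n := by exact_mod_cast hn1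
  have hn0 : (0 : ℝ) < n := by linarith
  set x : ℝ := (n : ℝ) ^ κ with hxdef
  have hnxy : (n : ℝ) = (n : ℝ) ^ (ψ + β) * x ^ 20 := by
    rw [hxdef, ← Real.rpow_natCast, ← Real.rpow_mul hn0.le, ← Real.rpow_add hn0]
    have : ψ + β + κ * ((20 : ℕ) : ℝ) = 1 := by rw [hκdef]; push_cast; ring
    rw [this, Real.rpow_one]
  have hmr : (Γ n * r n : ℝ) ≤ (n : ℝ) ^ (ψ + β) := by
    rw [Real.rpow_add hn0]
    rw [Real.norm_natCast, one_mul, Real.norm_of_nonneg (by positivity)] at hΓn hrn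
    exact mul_le_mul hΓn hrn (by positivity) (by positivity)
  have hVx : V₂ n ≤ x := by
    have h₁ : V₂ n ≤ V₁ n * V₂ n := by nlinarith [hV₁ n, hV₂ n]
    rw [one_mul, Real.norm_of_nonneg (Real.sqrt_nonneg _)] at hVn
    have h₂ : Real.sqrt (Real.log n) ≤ x := by
      rw [Real.sqrt_le_left (by linarith)]
      have h₃ : Real.log n ≤ Real.log (n + 1) := Real.log_le_log hn0 (by linarith)
      nlinarith
    exact h₁.trans ((le_abs_self _).trans (hVn.trans h₂))
  refine le_trans (measure_mono ?_) (measure_exists_network_deviation_le (hΓ n) hn1 (Z n) (ε n)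
    (hZ n) (hε n) (hind n) (hL2 n) (hcm n) (hvar n) (V₁ := V₁ n) (hV₂ n).le hx1
    (Real.one_le_rpow hn1' hψβ_pos.le) hnxy hmr hVx hlog hxp)
  rintro ω ⟨f, hf, hlt⟩
  exact ⟨f, hf, hηn.trans hlt⟩

/-! ### The basic inequality for sieve estimators -/

lemma empNorm_nonneg {A : Type*} (n : ℕ) (z : ℕ → A) (g : A → ℝ) : 0 ≤ empNorm n z g :=
  Real.sqrt_nonneg _

lemma empNorm_sq {A : Type*} (n : ℕ) (z : ℕ → A) (g : A → ℝ) :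
    empNorm n z g ^ 2 = (n : ℝ)⁻¹ * ∑ t ∈ Finset.range n, g (z t) ^ 2 :=
  Real.sq_sqrt (mul_nonneg (by positivity) (Finset.sum_nonneg fun _ _ => sq_nonneg _))

lemma empLoss_eq {A : Type*} (n : ℕ) (z : ℕ → A) (y ε : ℕ → ℝ) (f₀ f : A → ℝ)
    (hy : ∀ t, y t = f₀ (z t) + ε t) :
    empLoss n z y f = (n : ℝ)⁻¹ * ∑ t ∈ Finset.range n, ε t ^ 2
      + empNorm n z (f - f₀) ^ 2
      - 2 * ((n : ℝ)⁻¹ * ∑ t ∈ Finset.range n, ε t * f (z t))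
      + 2 * ((n : ℝ)⁻¹ * ∑ t ∈ Finset.range n, ε t * f₀ (z t)) := by
  rw [empNorm_sq, empLoss]
  simp only [Finset.mul_sum]
  rw [← Finset.sum_add_distrib, ← Finset.sum_sub_distrib, ← Finset.sum_add_distrib]
  refine Finset.sum_congr rfl fun t _ => ?_
  rw [hy, Pi.sub_apply]
  ring

/-- The terms with `ε ^ 2` and `ε * f₀` are common to both losses and cancel, so the noise has to be
controlled only along `f` and `g`, never along `f₀`. Each contributes `2 * δ`. -/
lemma empNorm_sq_le_of_empLoss_le {A : Type*} {n : ℕ} {z : ℕ → A} {y ε : ℕ → ℝ}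
    {f₀ f g : A → ℝ} (hy : ∀ t, y t = f₀ (z t) + ε t) {c δ : ℝ}
    (hloss : empLoss n z y f ≤ empLoss n z y g + c)
    (hf : (n : ℝ)⁻¹ * |∑ t ∈ Finset.range n, ε t * f (z t)| ≤ δ)
    (hg : (n : ℝ)⁻¹ * |∑ t ∈ Finset.range n, ε t * g (z t)| ≤ δ) :
    empNorm n z (f - f₀) ^ 2 ≤ empNorm n z (g - f₀) ^ 2 + c + 4 * δ := by
  rw [empLoss_eq n z y ε f₀ f hy, empLoss_eq n z y ε f₀ g hy] at hloss
  have hn : (0 : ℝ) ≤ (n : ℝ)⁻¹ := by positivity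
  have h₁ := mul_le_mul_of_nonneg_left (le_abs_self (∑ t ∈ Finset.range n, ε t * f (z t))) hn
  have h₂ := mul_le_mul_of_nonneg_left (neg_abs_le (∑ t ∈ Finset.range n, ε t * g (z t))) hn
  linarith

lemma IsHolder.continuous {E : Type*} [NormedAddCommGroup E] [NormedSpace ℝ E] {k : ℕ} {a : ℝ}
    {f : E → ℝ} (hf : IsHolder k a f) : Continuous f :=
  hf.1.continuous

lemma continuous_of_mem_holderCompositions {E : Type*} [NormedAddCommGroup E]
    [NormedSpace ℝ E] {k : ℕ} {a₁ a₂ : ℝ} {f : E → ℝ}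
    (hf : f ∈ holderCompositions E k a₁ a₂) : Continuous f := by
  obtain ⟨q, f₁, f₂, h₁, h₂, rfl⟩ := hf
  exact h₂.continuous.comp (continuous_pi fun j => (h₁ j).continuous)

end SpatialDNN

/-! ### Consistency: the basic inequality combined with the uniform deviation bound. -/

theorem theorem2
    {Ω : Type*} [MeasurableSpace Ω] (μ : Measure Ω) [IsProbabilityMeasure μ]
    {d p : ℕ}
    -- the sampling design, the target sites and the neighbouring sites that are used
    (D : SpatialDNN.SpatialDesign d)
    (s : ℕ → EuclideanSpace ℝ (Fin d)) (hs : ∀ n, s n ∈ D.sites n)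
    (Γ : ℕ → ℕ) (hΓ : ∀ n, 0 < Γ n)
    (σ : ∀ n, Fin (Γ n) → EuclideanSpace ℝ (Fin d))
    (hσ_inj : ∀ n, Function.Injective (σ n))
    (hσ : ∀ n l, σ n l ∈ D.neighbourhood n (s n))
    -- the random fields and the regression model
    (X : ℕ → EuclideanSpace ℝ (Fin d) → Ω → Fin p → ℝ)
    (Y noise : ℕ → EuclideanSpace ℝ (Fin d) → Ω → ℝ)
    (hiid : SpatialDNN.IsIIDFields μ X Y)
    (k : ℕ) (a₁ a₂ : ℝ) (ha₁ : a₁ ∈ Set.Ioo (0 : ℝ) 1) (ha₂ : a₂ ∈ Set.Ioo (0 : ℝ) 1)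
    (f₀ : ∀ n, SpatialDNN.Input p (Γ n) → ℝ)
    (hf₀ : ∀ n, f₀ n ∈ SpatialDNN.holderCompositions (SpatialDNN.Input p (Γ n)) k a₁ a₂)
    (sd : ℝ)
    (hreg : ∀ n, SpatialDNN.IsRegression μ X Y noise sd (s n) (σ n) (f₀ n))
    -- the sieve of networks and its approximation property at the regression function
    (r : ℕ → ℕ) (V₁ V₂ : ℕ → ℝ) (hV₁ : ∀ n, 1 < V₁ n) (hV₂ : ∀ n, 1 < V₂ n)
    (hsieve : ∃ g : ∀ n, SpatialDNN.Input p (Γ n) → ℝ,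
      (∀ n, g n ∈ SpatialDNN.networks p (Γ n) (r n) (V₁ n) (V₂ n)) ∧
      TendstoInMeasure μ
        (fun n ω => SpatialDNN.empNorm n
          (fun t => SpatialDNN.inputAt X Y (s n) (σ n) t ω) (g n - f₀ n))
        atTop (fun _ => (0 : ℝ)))
    -- growth conditions
    (ψ β : ℝ) (hψβ_pos : 0 < ψ + β) (hψβ_lt : ψ + β < 1)
    (hΓ_growth : (fun n => (Γ n : ℝ)) =o[atTop] (fun n : ℕ => (n : ℝ) ^ ψ))
    (hlam_growth : D.lam =o[atTop] (fun n : ℕ => (n : ℝ)))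
    (hr_growth : (fun n => (r n : ℝ)) =o[atTop] (fun n : ℕ => (n : ℝ) ^ β))
    (hV₂_growth : (fun n => V₂ n * Real.sqrt (sd ^ 2 + 1)) =o[atTop]
      (fun n => (r n : ℝ) ^ 2))
    (hV_growth : (fun n => V₁ n * V₂ n) =o[atTop]
      (fun n : ℕ => Real.sqrt (Real.log n)))
    -- finite VC dimension and bounded envelope
    (ν : ℕ → ℕ)
    (hVC : ∀ n, SpatialDNN.vcDim
      (SpatialDNN.networks p (Γ n) (r n) (V₁ n) (V₂ n)) = (ν n : ℕ∞))
    (henv : ∀ n, ∃ G : SpatialDNN.Input p (Γ n) → ℝ,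
      (∀ f ∈ SpatialDNN.networks p (Γ n) (r n) (V₁ n) (V₂ n), ∀ z, |f z| ≤ G z) ∧
      ∀ z, G z ≤ min (V₁ n) (V₂ n))
    -- controlled covering numbers
    (hcover : ∃ C : ℝ, 0 < C ∧ ∀ n, ∀ᵐ ω ∂μ, ∀ φ : ℝ, 0 < φ → φ < 1 →
      ∃ N : ℕ, SpatialDNN.empCoveringNumber n
          (fun t => SpatialDNN.inputAt X Y (s n) (σ n) t ω)
          (SpatialDNN.networks p (Γ n) (r n) (V₁ n) (V₂ n)) φ = (N : ℕ∞) ∧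
        Real.log N ≤ ν n * C * φ ^ (-(d : ℝ)))
    -- the estimator
    (fhat : ∀ n, Ω → SpatialDNN.Input p (Γ n) → ℝ)
    (hfhat : SpatialDNN.IsSieveEstimator μ
      (fun n => SpatialDNN.networks p (Γ n) (r n) (V₁ n) (V₂ n))
      (fun n ω f => SpatialDNN.empLoss n
        (fun t => SpatialDNN.inputAt X Y (s n) (σ n) t ω) (fun t => Y t (s n) ω) f)
      fhat) :
    TendstoInMeasure μ
      (fun n ω => SpatialDNN.empNorm n
        (fun t => SpatialDNN.inputAt X Y (s n) (σ n) t ω) (fhat n ω - f₀ n))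
      atTop (fun _ => (0 : ℝ)) := by
  obtain ⟨g, hg, hgf₀⟩ := hsieve
  set Z : ∀ n, ℕ → Ω → SpatialDNN.Input p (Γ n) :=
    fun n t ω => SpatialDNN.inputAt X Y (s n) (σ n) t ω with hZdef
  set ε : ℕ → ℕ → Ω → ℝ := fun n t => noise t (s n) with hεdef
  have hXl : ∀ t u, Measurable (X t u) := hiid.measurable_X
  have hYl : ∀ t u, Measurable (Y t u) := hiid.measurable_Y
  have hZ : ∀ n t, Measurable (Z n t) := fun n t =>
    (hXl t _).prodMk ((measurable_pi_lambda _ fun l => hXl t _).prodMk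
      (measurable_pi_lambda _ fun l => hYl t _))
  have hf₀m : ∀ n, Measurable (f₀ n) := fun n =>
    (SpatialDNN.continuous_of_mem_holderCompositions (hf₀ n)).measurable
  -- The noise is a measurable function of the `t`-th copy of the fields, since `f₀ n` is
  -- continuous. Hence it inherits measurability, and the pairs `(Z n t, ε n t)` inherit
  -- independence in `t`.
  have hεeq : ∀ n t ω, ε n t ω = Y t (s n) ω - f₀ n (Z n t ω) := fun n t ω => by
    rw [(hreg n).model t ω]
    simp only [hZdef, hεdef]
    ring
  have hε : ∀ n t, Measurable (ε n t) := fun n t => by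
    rw [funext (hεeq n t)]
    exact (hYl t _).sub ((hf₀m n).comp (hZ n t))
  have hind : ∀ n, iIndepFun (fun t ω => (Z n t ω, ε n t ω)) μ := by
    intro n
    let F : (EuclideanSpace ℝ (Fin d) → ℝ × (Fin p → ℝ)) → SpatialDNN.Input p (Γ n) :=
      fun h => ((h (s n)).2, fun l => (h (σ n l)).2, fun l => (h (σ n l)).1)
    have hF : Measurable F := (measurable_pi_apply _).snd.prodMk
      ((measurable_pi_lambda _ fun l => (measurable_pi_apply _).snd).prodMk
        (measurable_pi_lambda _ fun l => (measurable_pi_apply _).fst))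
    have h := hiid.indep.comp (fun _ h => (F h, (h (s n)).1 - f₀ n (F h)))
      (fun _ => hF.prodMk ((measurable_pi_apply _).fst.sub ((hf₀m n).comp hF)))
    have heq : (fun t ω => (Z n t ω, ε n t ω)) = fun t =>
        (fun h : EuclideanSpace ℝ (Fin d) → ℝ × (Fin p → ℝ) =>
          (F h, (h (s n)).1 - f₀ n (F h))) ∘ fun ω u => (Y t u ω, X t u ω) := by
      funext t ω
      rw [hεeq]
      rfl
    rw [heq]
    exact h
  have hdev := fun {η : ℝ} (hη : 0 < η) =>
    SpatialDNN.tendsto_measure_exists_network_deviation Γ hΓ Z ε hZ hε hind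
      (fun n => (hreg n).memLp) (fun n => (hreg n).condMean) (fun n => (hreg n).variance)
      r V₁ V₂ hV₁ hV₂ hψβ_pos hψβ_lt hΓ_growth hr_growth hV_growth hη
  obtain ⟨Ξ, hΞ, hmin⟩ := hfhat.near_min
  rw [tendstoInMeasure_iff_norm] at hgf₀ ⊢
  intro η hη
  rw [ENNReal.tendsto_nhds_zero]
  intro ζ hζ
  obtain ⟨ξ, hξ, hξζ⟩ : ∃ ξ : ℝ, 0 < ξ ∧ ENNReal.ofReal ξ ≤ ζ / 3 := by
    -- The minimum with 1 keeps `ξ` real when `ζ` is infinite.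
    have h3 : 0 < min (ζ / 3) 1 :=
      lt_min (ENNReal.div_pos hζ.ne' ENNReal.ofNat_ne_top) one_pos
    have htop : min (ζ / 3) 1 ≠ ⊤ := ne_top_of_le_ne_top ENNReal.one_ne_top (min_le_right _ _)
    exact ⟨(min (ζ / 3) 1).toReal, ENNReal.toReal_pos h3.ne' htop, by
      rw [ENNReal.ofReal_toReal htop]; exact min_le_left _ _⟩
  obtain ⟨M, hM⟩ := hmin ξ hξ
  have hζ3 : 0 < ζ / 3 := ENNReal.div_pos hζ.ne' ENNReal.ofNat_ne_top
  have hMΞ : Tendsto (fun n => M * |Ξ n|) atTop (𝓝 0) := by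
    simpa using (hΞ.abs).const_mul M
  -- Three bad events share `ζ`: failure of near-minimality, of approximation, and of the noise
  -- bound. Off them the basic inequality gives `‖fhat - f₀‖ₙ² < η² / 4 + η² / 4 + 4 * (η² / 16) <
  -- η²`.
  filter_upwards [hM, (ENNReal.tendsto_nhds_zero.1 (hgf₀ (η / 2) (by positivity))) _ hζ3,
    (ENNReal.tendsto_nhds_zero.1 (hdev (show 0 < η ^ 2 / 16 by positivity))) _ hζ3,
    hMΞ.eventually_lt_const (show 0 < η ^ 2 / 4 by positivity)] with n h₁ h₂ h₃ h₄
  refine (measure_mono ?_).trans ((measure_union_le _ _).trans (add_le_add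
    ((measure_union_le _ _).trans (add_le_add (h₁.trans hξζ) h₂)) h₃) |>.trans_eq
      (ENNReal.add_thirds ζ))
  intro ω hω
  by_contra hnot
  have hnot' := not_or.1 hnot
  obtain ⟨hno₁, hno₂⟩ := not_or.1 hnot'.1
  have hno₃ : ¬ ∃ f ∈ SpatialDNN.networks p (Γ n) (r n) (V₁ n) (V₂ n),
      η ^ 2 / 16 < (n : ℝ)⁻¹ * |∑ t ∈ Finset.range n, ε n t ω * f (Z n t ω)| := hnot'.2
  have hb₁ : SpatialDNN.empLoss n (fun t => Z n t ω) (fun t => Y t (s n) ω) (fhat n ω) ≤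
      (⨅ f : SpatialDNN.networks p (Γ n) (r n) (V₁ n) (V₂ n),
        SpatialDNN.empLoss n (fun t => Z n t ω) (fun t => Y t (s n) ω) f) + M * |Ξ n| :=
    not_lt.1 fun h => hno₁ h
  have hb₂ : ‖SpatialDNN.empNorm n (fun t => Z n t ω) (g n - f₀ n) - 0‖ < η / 2 :=
    not_le.1 fun h => hno₂ h
  have hω' : η ≤ ‖SpatialDNN.empNorm n (fun t => Z n t ω) (fhat n ω - f₀ n) - 0‖ := hω
  rw [sub_zero, Real.norm_of_nonneg (SpatialDNN.empNorm_nonneg _ _ _)] at hω' hb₂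
  have hinf : (⨅ f : SpatialDNN.networks p (Γ n) (r n) (V₁ n) (V₂ n),
      SpatialDNN.empLoss n (fun t => Z n t ω) (fun t => Y t (s n) ω) f)
      ≤ SpatialDNN.empLoss n (fun t => Z n t ω) (fun t => Y t (s n) ω) (g n) :=
    ciInf_le ⟨0, by
      rintro _ ⟨f, rfl⟩
      exact mul_nonneg (by positivity) (Finset.sum_nonneg fun _ _ => sq_nonneg _)⟩
      (⟨g n, hg n⟩ : SpatialDNN.networks p (Γ n) (r n) (V₁ n) (V₂ n))
  have hbasic := SpatialDNN.empNorm_sq_le_of_empLoss_le (z := fun t => Z n t ω)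
    (y := fun t => Y t (s n) ω) (ε := fun t => ε n t ω) (f₀ := f₀ n) (f := fhat n ω) (g := g n)
    (fun t => (hreg n).model t ω) (c := M * |Ξ n|) (δ := η ^ 2 / 16)
    (hb₁.trans (add_le_add_left hinf _))
    (not_lt.1 fun h => hno₃ ⟨_, hfhat.mem n ω, h⟩) (not_lt.1 fun h => hno₃ ⟨_, hg n, h⟩)
  have hg0 : 0 ≤ SpatialDNN.empNorm n (fun t => Z n t ω) (g n - f₀ n) :=
    SpatialDNN.empNorm_nonneg _ _ _
  have hq₁ : η ^ 2 ≤ SpatialDNN.empNorm n (fun t => Z n t ω) (fhat n ω - f₀ n) ^ 2 := by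
    gcongr
  have hq₂ : SpatialDNN.empNorm n (fun t => Z n t ω) (g n - f₀ n) ^ 2 < (η / 2) ^ 2 := by
    gcongr
  nlinarith
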